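/- **Setting.** Let $A\in\mathbb R^{m\times n}$ with $m<n$ and $M\in\mathbb R^{m\times q}$ with $m\le q$, $\operatorname{rank}A=\operatorname{rank}M=m$; let $y\in\mathbb R^m$, $\tau\ge 0$, $\alpha\in[0,1]$, and let $k\ge 0$ be an integer. Consider the problem $$\min_x\{\|x\|_1:\ \alpha\|M^T(Ax-y)\|_\infty+(1-\alpha)\|M^T(Ax-y)\|_1\le\tau\}.\qquad (\mathrm{P})$$ Put $\sigma_k(x)_1=\inf\{\|x-u\|_1:\ u \text{ has at most } k \text{ nonzero entries}\}$, $\vartheta(x)=M^T(Ax-y)$, $t^+=\max\{t,0\}$, and $$c=\max_{G}\ \|M_G^{-1}(AA^T)^{-1}A\|_{\infty\to1},\qquad \|Q\|_{\infty\to 1}=\max_{\|x\|_\infty\le 1}\|Qx\|_1,$$ where $G$ runs over the sets of $m$ column indices of $M$ for which the submatrix $M_G\in\mathbb R^{m\times m}$ with columns in $G$ is invertible. *Robinson's constant.* For matrices $N',N''$ with the same number of columns let $$\mu_{\infty,2}(N',N'')=\max_{(d',d'')}\ \min_u\{\|u\|_\infty:\ N'u\le d',\ N''u=d''\},$$ the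 maximum being over all $(d',d'')$ with $\|(d',d'')\|_2\le1$ for which $N'u\le d'$, $N''u=d''$ is solvable. For $M^1$ with $m_1$ rows and $M^2$ with $m_2$ rows, with the same number of columns, let $$\sigma_{\infty,2}(M^1,M^2)=\max_{S\subseteq\{1,\dots,m_1\}}\mu_{\infty,2}\left(\begin{bmatrix}I_S&0\\-I&0\end{bmatrix},\begin{bmatrix}M^1\\M^2\end{bmatrix}^T\right),$$ where $I$ is the $m_1\times m_1$ identity matrix and $I_S$ consists of its rows with index in $S$. Let $\gamma=\sigma_{\infty,2}(M^1,M^2)$ for the following matrices. They act on the vectors $z=(x,t,\xi,v,w^{(1)},\dots,w^{(7)})$ with $x,t,w^{(1)},w^{(2)}\in\mathbb R^n$, $\xi,w^{(3)}\in\mathbb R$, $v,w^{(4)},\dots,w^{(7)}\in\mathbb R^q$. The blocks of $M^1z$ are, in this order ($\mathbf e$ is the all-ones vector of the suitable size), $$x-t,\quad -x-t,\quad \alpha\xi+(1-\alpha)\mathbf e^Tv,\quad M^TAx-\xi\mathbf e,\quad -M^TAx-\xi\mathbf e,\quad M^TAx-v,\quad -M^TAx-v,$$ $$w^{(1)}+w^{(2)},\quad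 -\alpha w^{(3)}+\mathbf e^Tw^{(4)}+\mathbf e^Tw^{(5)},\quad -(1-\alpha)w^{(3)}\mathbf e+w^{(6)}+w^{(7)},\quad -w^{(1)},\dots,-w^{(7)},$$ and the blocks of $M^2z$ are $$-w^{(1)}+w^{(2)}+A^TM\big(w^{(4)}-w^{(5)}-w^{(6)}+w^{(7)}\big),\qquad \mathbf e^Tt+\tau w^{(3)}-y^TM\big(w^{(4)}-w^{(5)}-w^{(6)}+w^{(7)}\big).$$ **Hypothesis.** Suppose that at least one of the following holds. (a) The columns $a_1,\dots,a_n$ of $A$ have Euclidean norm $1$ and $\mu_1(k)+\mu_1(k-1)<1$, where $\mu_1(s)=\max\{\sum_{j\in S}|\langle a_i,a_j\rangle|:\ 1\le i\le n,\ S\subseteq\{1,\dots,n\}\setminus\{i\},\ |S|\le s\}$ (for $k=0$ read $\mu_1(k-1)$ as $0$). (b) RIP of order $2k$ with a constant $\delta_{2k}\in(0,1)$, $\delta_{2k}<1/\sqrt2$: $(1-\delta_{2k})\|x\|_2^2\le\|Ax\|_2^2\le(1+\delta_{2k})\|x\|_2^2$ for every $x\in\mathbb R^n$ with at most $2k$ nonzero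 entries. (c) Stable NSP of order $k$: there is $\rho\in(0,1)$ with $\|\zeta_S\|_1\le\rho\|\zeta_{\overline S}\|_1$ for all $\zeta\in\ker A\setminus\{0\}$ and all $S\subseteq\{1,\dots,n\}$ with $|S|\le k$, where $\overline S$ is the complement of $S$. (d) Robust NSP of order $k$: there are $\rho'\in(0,1)$ and $\rho''>0$ with $\|\zeta_S\|_1\le\rho'\|\zeta_{\overline S}\|_1+\rho''\|A\zeta\|_2$ for all $\zeta\in\ker A\setminus\{0\}$ and all $S$ with $|S|\le k$. (This holds in particular if the inequality holds for all $\zeta\in\mathbb R^n$.) (e) NSP of order $k$: $\|\zeta_S\|_1<\|\zeta_{\overline S}\|_1$ for all $\zeta\in\ker A\setminus\{0\}$ and all $S$ with $|S|\le k$. (f) RSP of order $k$ of $A^T$: for all disjoint $S_1,S_2\subseteq\{1,\dots,n\}$ with $|S_1|+|S_2|\le k$ there is $\zeta$ in the range of $A^T$ with $\zeta_i=1$ for $i\in S_1$, $\zeta_i=-1$ for $i\in S_2$, and $|\zeta_i|<1$ for $i\notin S_1\cup S_2$. **Conclusion.** $A^T$ has the weak RSP of order $k$, that is, (f) holds with $|\zeta_i|\le1$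 in place of $|\zeta_i|<1$. For every $x\in\mathbb R^n$ there is an optimal solution $x^*$ of (P) with $$\|x-x^*\|_2\le\gamma\left\{\big(\alpha\|\vartheta(x)\|_\infty+(1-\alpha)\|\vartheta(x)\|_1-\tau\big)^++2\sigma_k(x)_1+c\big(\tau+\|\vartheta(x)\|_\infty\big)\right\}.$$ In particular, for every $x$ satisfying the constraint of (P) there is an optimal solution $x^*$ of (P) with $$\|x-x^*\|_2\le\gamma\left\{2\sigma_k(x)_1+c\tau+c\|M^T(Ax-y)\|_\infty\right\}\le2\gamma\left\{\sigma_k(x)_1+c\tau\right\}.$$ -/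

import Mathlib

open scoped ENNReal Matrix

noncomputable section

namespace DantzigStability

/-! Vectors are plain functions `ι → ℝ`; all norms are made explicit. -/

/-- The `ℓ_p`-norm of a real vector, `p ∈ [1, ∞]` (used with `p = 1, 2, ⊤`). -/
def lpN {ι : Type*} [Fintype ι] (p : ℝ≥0∞) (v : ι → ℝ) : ℝ := ‖WithLp.toLp p v‖

/-- `‖x‖₀`, the number of nonzero entries. -/
def l0 {n : ℕ} (x : Fin n → ℝ) : ℕ := {i | x i ≠ 0}.ncard

/-- The error `σ_k(x)₁` of the best `k`-term approximation in the `ℓ₁`-norm. -/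
def bestApprox {n : ℕ} (k : ℕ) (x : Fin n → ℝ) : ℝ :=
  sInf {r | ∃ u : Fin n → ℝ, l0 u ≤ k ∧ r = lpN 1 (x - u)}

/-- The induced matrix norm `‖Q‖_{p → p'} = max {‖Q x‖_{p'} : ‖x‖_p ≤ 1}`. -/
def inducedN {ι κ : Type*} [Fintype ι] [Fintype κ] (p p' : ℝ≥0∞) (Q : Matrix ι κ ℝ) : ℝ :=
  sSup {r | ∃ x : κ → ℝ, lpN p x ≤ 1 ∧ r = lpN p' (Q *ᵥ x)}

/-! ### Robinson's constant -/

/-- `μ_{a,b}(M', M'')`: the maximum, over the right-hand sides `(d', d'')` with `‖(d', d'')‖_b ≤ 1`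
for which the system `M' u ≤ d'`, `M'' u = d''` is solvable, of the least `‖u‖_a` of a solution. -/
def hoffmanMu {P₁ P₂ Q : Type*} [Fintype P₁] [Fintype P₂] [Fintype Q] (a b : ℝ≥0∞)
    (M' : Matrix P₁ Q ℝ) (M'' : Matrix P₂ Q ℝ) : ℝ :=
  sSup {r | ∃ (d' : P₁ → ℝ) (d'' : P₂ → ℝ),
    (∃ u : Q → ℝ, M' *ᵥ u ≤ d' ∧ M'' *ᵥ u = d'') ∧
    lpN b (Sum.elim d' d'') ≤ 1 ∧
    r = sInf {s | ∃ u : Q → ℝ, M' *ᵥ u ≤ d' ∧ M'' *ᵥ u = d'' ∧ s = lpN a u}}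

/-- Robinson's constant `σ_{a,b}(M¹, M²)`: the maximum over all sets `S` of row indices of `M¹` of
`μ_{a,b}([I_S 0; -I 0], [M¹; M²]ᵀ)`, where `I_S` consists of the rows of `I` with index in `S`. -/
def robinson {R₁ R₂ L : Type*} [Fintype R₁] [DecidableEq R₁] [Fintype R₂] [Fintype L]
    (a b : ℝ≥0∞) (M₁ : Matrix R₁ L ℝ) (M₂ : Matrix R₂ L ℝ) : ℝ :=
  ⨆ S : Finset R₁,
    hoffmanMu a b
      (Matrix.fromBlocks
        ((1 : Matrix R₁ R₁ ℝ).submatrix (Subtype.val : {i // i ∈ S} → R₁) id)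
        (0 : Matrix {i // i ∈ S} R₂ ℝ)
        (-1 : Matrix R₁ R₁ ℝ)
        (0 : Matrix R₁ R₂ ℝ))
      (Matrix.fromRows M₁ M₂)ᵀ

/-! ### The problem and the matrices of its optimality system -/

/-- The constraint `α ‖Mᵀ(Ax - y)‖_∞ + (1 - α) ‖Mᵀ(Ax - y)‖₁ ≤ τ`. -/
def Feasible {m n q : ℕ} (A : Matrix (Fin m) (Fin n) ℝ) (M : Matrix (Fin m) (Fin q) ℝ)
    (y : Fin m → ℝ) (τ α : ℝ) (x : Fin n → ℝ) : Prop :=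
  α * lpN ⊤ (Mᵀ *ᵥ (A *ᵥ x - y)) + (1 - α) * lpN 1 (Mᵀ *ᵥ (A *ᵥ x - y)) ≤ τ

/-- `x` minimizes `‖x‖₁` subject to the constraint. -/
def IsOptimal {m n q : ℕ} (A : Matrix (Fin m) (Fin n) ℝ) (M : Matrix (Fin m) (Fin q) ℝ)
    (y : Fin m → ℝ) (τ α : ℝ) (x : Fin n → ℝ) : Prop :=
  Feasible A M y τ α x ∧ ∀ z, Feasible A M y τ α z → lpN 1 x ≤ lpN 1 z

/-- Index type of the unknowns `(x, t, ξ, v, w⁽¹⁾, …, w⁽⁷⁾)`. -/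
abbrev Cols (n q : ℕ) : Type :=
  Fin n ⊕ Fin n ⊕ Unit ⊕ Fin q ⊕ Fin n ⊕ Fin n ⊕ Unit ⊕ Fin q ⊕ Fin q ⊕ Fin q ⊕ Fin q

/-- A block row `[B₁ B₂ … B₁₁]`. -/
def blockRow {n q : ℕ} {R : Type} (B₁ : Matrix R (Fin n) ℝ) (B₂ : Matrix R (Fin n) ℝ)
    (B₃ : Matrix R Unit ℝ) (B₄ : Matrix R (Fin q) ℝ) (B₅ : Matrix R (Fin n) ℝ)
    (B₆ : Matrix R (Fin n) ℝ) (B₇ : Matrix R Unit ℝ) (B₈ : Matrix R (Fin q) ℝ)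
    (B₉ : Matrix R (Fin q) ℝ) (B₁₀ : Matrix R (Fin q) ℝ) (B₁₁ : Matrix R (Fin q) ℝ) :
    Matrix R (Cols n q) ℝ :=
  .fromCols B₁ <| .fromCols B₂ <| .fromCols B₃ <| .fromCols B₄ <| .fromCols B₅ <|
    .fromCols B₆ <| .fromCols B₇ <| .fromCols B₈ <| .fromCols B₉ <| .fromCols B₁₀ B₁₁

/-- The all-ones column `e`. -/
def onesCol (R : Type) : Matrix R Unit ℝ := Matrix.of fun _ _ => 1

/-- Index type of the rows of `M¹`, block by block. -/
abbrev Rows₁ (n q : ℕ) : Type :=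
  Fin n ⊕ Fin n ⊕ Unit ⊕ Fin q ⊕ Fin q ⊕ Fin q ⊕ Fin q ⊕ Fin n ⊕ Unit ⊕ Fin q ⊕
    Fin n ⊕ Fin n ⊕ Unit ⊕ Fin q ⊕ Fin q ⊕ Fin q ⊕ Fin q

/-- The inequality matrix `M¹`. -/
def matM₁ {m n q : ℕ} (A : Matrix (Fin m) (Fin n) ℝ) (M : Matrix (Fin m) (Fin q) ℝ) (α : ℝ) :
    Matrix (Rows₁ n q) (Cols n q) ℝ :=
  .fromRows (blockRow 1 (-1) 0 0 0 0 0 0 0 0 0) <|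
  .fromRows (blockRow (-1) (-1) 0 0 0 0 0 0 0 0 0) <|
  .fromRows (blockRow 0 0 (α • 1) ((1 - α) • (onesCol (Fin q))ᵀ) 0 0 0 0 0 0 0) <|
  .fromRows (blockRow (Mᵀ * A) 0 (-onesCol (Fin q)) 0 0 0 0 0 0 0 0) <|
  .fromRows (blockRow (-(Mᵀ * A)) 0 (-onesCol (Fin q)) 0 0 0 0 0 0 0 0) <|
  .fromRows (blockRow (Mᵀ * A) 0 0 (-1) 0 0 0 0 0 0 0) <|
  .fromRows (blockRow (-(Mᵀ * A)) 0 0 (-1) 0 0 0 0 0 0 0) <|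
  .fromRows (blockRow 0 0 0 0 1 1 0 0 0 0 0) <|
  .fromRows (blockRow 0 0 0 0 0 0 (-(α • 1)) (onesCol (Fin q))ᵀ (onesCol (Fin q))ᵀ 0 0) <|
  .fromRows (blockRow 0 0 0 0 0 0 (-((1 - α) • onesCol (Fin q))) 0 0 1 1) <|
  .fromRows (blockRow 0 0 0 0 (-1) 0 0 0 0 0 0) <|
  .fromRows (blockRow 0 0 0 0 0 (-1) 0 0 0 0 0) <|
  .fromRows (blockRow 0 0 0 0 0 0 (-1) 0 0 0 0) <|
  .fromRows (blockRow 0 0 0 0 0 0 0 (-1) 0 0 0) <|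
  .fromRows (blockRow 0 0 0 0 0 0 0 0 (-1) 0 0) <|
  .fromRows (blockRow 0 0 0 0 0 0 0 0 0 (-1) 0) <|
    (blockRow 0 0 0 0 0 0 0 0 0 0 (-1))

/-- The row vector `yᵀ M`. -/
def yTM {m q : ℕ} (M : Matrix (Fin m) (Fin q) ℝ) (y : Fin m → ℝ) : Matrix Unit (Fin q) ℝ :=
  Matrix.of fun _ => y ᵥ* M

/-- The equality matrix `M²`. -/
def matM₂ {m n q : ℕ} (A : Matrix (Fin m) (Fin n) ℝ) (M : Matrix (Fin m) (Fin q) ℝ)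
    (y : Fin m → ℝ) (τ : ℝ) : Matrix (Fin n ⊕ Unit) (Cols n q) ℝ :=
  .fromRows
    (blockRow 0 0 0 0 (-1) 1 0 (Aᵀ * M) (-(Aᵀ * M)) (-(Aᵀ * M)) (Aᵀ * M))
    (blockRow 0 (onesCol (Fin n))ᵀ 0 0 0 0 (τ • 1) (-yTM M y) (yTM M y) (yTM M y) (-yTM M y))

/-- `γ = σ_{∞,2}(M¹, M²)`. -/
def gammaConst {m n q : ℕ} (A : Matrix (Fin m) (Fin n) ℝ) (M : Matrix (Fin m) (Fin q) ℝ)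
    (y : Fin m → ℝ) (τ α : ℝ) : ℝ :=
  robinson ⊤ 2 (matM₁ A M α) (matM₂ A M y τ)

/-- `c`, the maximum of `‖M_G⁻¹ (A Aᵀ)⁻¹ A‖_{∞ → 1}` over the sets `G` of `m` columns of `M` for
which the submatrix `M_G` is invertible (the columns of `M_G` are kept in increasing order). -/
def cConst {m n q : ℕ} (A : Matrix (Fin m) (Fin n) ℝ) (M : Matrix (Fin m) (Fin q) ℝ) : ℝ :=
  sSup {r | ∃ (G : Finset (Fin q)) (hG : G.card = m),
    IsUnit (M.submatrix id (G.orderEmbOfFin hG)) ∧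
    r = inducedN ⊤ 1 ((M.submatrix id (G.orderEmbOfFin hG))⁻¹ * (A * Aᵀ)⁻¹ * A)}

/-! ### Matrix conditions -/

/-- Weak range space property of order `k` of `Aᵀ`. -/
def WeakRSP {m n : ℕ} (A : Matrix (Fin m) (Fin n) ℝ) (k : ℕ) : Prop :=
  ∀ S₁ S₂ : Finset (Fin n), Disjoint S₁ S₂ → S₁.card + S₂.card ≤ k →
    ∃ ζ : Fin n → ℝ, (∃ u, ζ = Aᵀ *ᵥ u) ∧ (∀ i ∈ S₁, ζ i = 1) ∧ (∀ i ∈ S₂, ζ i = -1) ∧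
      ∀ i, i ∉ S₁ ∪ S₂ → |ζ i| ≤ 1

/-- Range space property of order `k` of `Aᵀ`. -/
def RSP {m n : ℕ} (A : Matrix (Fin m) (Fin n) ℝ) (k : ℕ) : Prop :=
  ∀ S₁ S₂ : Finset (Fin n), Disjoint S₁ S₂ → S₁.card + S₂.card ≤ k →
    ∃ ζ : Fin n → ℝ, (∃ u, ζ = Aᵀ *ᵥ u) ∧ (∀ i ∈ S₁, ζ i = 1) ∧ (∀ i ∈ S₂, ζ i = -1) ∧
      ∀ i, i ∉ S₁ ∪ S₂ → |ζ i| < 1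

/-- Null space property of order `k`. -/
def NSP {m n : ℕ} (A : Matrix (Fin m) (Fin n) ℝ) (k : ℕ) : Prop :=
  ∀ ζ : Fin n → ℝ, ζ ≠ 0 → A *ᵥ ζ = 0 → ∀ S : Finset (Fin n), S.card ≤ k →
    ∑ i ∈ S, |ζ i| < ∑ i ∈ Sᶜ, |ζ i|

/-- Stable null space property of order `k` with constant `ρ`. -/
def StableNSP {m n : ℕ} (A : Matrix (Fin m) (Fin n) ℝ) (k : ℕ) (ρ : ℝ) : Prop :=
  ∀ ζ : Fin n → ℝ, ζ ≠ 0 → A *ᵥ ζ = 0 → ∀ S : Finset (Fin n), S.card ≤ k →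
    ∑ i ∈ S, |ζ i| ≤ ρ * ∑ i ∈ Sᶜ, |ζ i|

/-- Robust null space property of order `k` with constants `ρ'`, `ρ''`. As in the source, the
inequality is required only for nonzero `ζ` in the null space of `A`; the customary definition,
which requires it for all `ζ ∈ ℝⁿ` (and whatever norm is used for `Aζ`), is a stronger condition,
so as a hypothesis the present one covers it. -/
def RobustNSP {m n : ℕ} (A : Matrix (Fin m) (Fin n) ℝ) (k : ℕ) (ρ' ρ'' : ℝ) : Prop :=
  ∀ ζ : Fin n → ℝ, ζ ≠ 0 → A *ᵥ ζ = 0 → ∀ S : Finset (Fin n), S.card ≤ k →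
    ∑ i ∈ S, |ζ i| ≤ ρ' * ∑ i ∈ Sᶜ, |ζ i| + ρ'' * lpN 2 (A *ᵥ ζ)

/-- Restricted isometry property of order `s` with constant `δ ∈ (0, 1)`. -/
def RIP {m n : ℕ} (A : Matrix (Fin m) (Fin n) ℝ) (s : ℕ) (δ : ℝ) : Prop :=
  0 < δ ∧ δ < 1 ∧ ∀ x : Fin n → ℝ, l0 x ≤ s →
    (1 - δ) * lpN 2 x ^ 2 ≤ lpN 2 (A *ᵥ x) ^ 2 ∧
    lpN 2 (A *ᵥ x) ^ 2 ≤ (1 + δ) * lpN 2 x ^ 2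

/-- The columns `a_j` of `A` have Euclidean norm one. -/
def NormalizedCols {m n : ℕ} (A : Matrix (Fin m) (Fin n) ℝ) : Prop :=
  ∀ j, lpN 2 (fun i => A i j) = 1

/-- The `ℓ₁`-coherence function `μ₁(s) = max_i max {∑_{j ∈ S} |⟨a_i, a_j⟩| : |S| = s, i ∉ S}` of
`A`, `0 ≤ s ≤ n - 1`. Since the summands are nonnegative, `|S| = s` may be replaced by `|S| ≤ s`;
this also gives the value `μ₁(n - 1)` instead of a maximum of the empty set when `s ≥ n`. -/
def coherence {m n : ℕ} (A : Matrix (Fin m) (Fin n) ℝ) (s : ℕ) : ℝ :=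
  sSup {r | ∃ (i : Fin n) (S : Finset (Fin n)), S.card ≤ s ∧ i ∉ S ∧
    r = ∑ j ∈ S, |∑ l, A l i * A l j|}

end DantzigStability

end

noncomputable section

namespace DantzigStability

/-! ### The `ℓ_p`-norms -/

/-! With the norms linearized, (P) is a linear program in (x, t, ξ, v). The system `matM₁ *ᵥ z ≤
rhs₁`, `matM₂ *ᵥ z = 0` says that (x, t, ξ, v) is primal feasible, that w is dual feasible and that
the duality gap is zero. By weak duality the x-part of every solution is optimal for (P); by strong
duality (`exists_system`) solutions exist. Hoffman's bound (`exists_lpN_sub_le_robinson`) puts a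
solution within γ times the ℓ₁-residual of any given z.

It remains to complete x to a z of small residual. The choice t = |x|, ξ = ‖ϑ‖_∞, v = |ϑ| violates
only the row with right-hand side τ, which gives the first term of the bound. For w, the weak RSP
supplies ζ = Aᵀu with ‖ζ‖_∞ ≤ 1 that agrees with the signs of x on its k largest entries, so ‖x‖₁ −
x·ζ ≤ 2σ_k(x)₁. Moreover u = Mh with ‖h‖₁ ≤ c. The positive and negative parts of ζ and h, with w⁽³⁾
= ‖h‖₁, are dual feasible, and the gap is ‖x‖₁ − x·ζ + ϑ·h + τ‖h‖₁, which gives the other terms.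

For the weak RSP, (a)–(d) each imply the null space property (e), and (f) is stronger outright.
Under (e) the sign vector x₀ of (S₁, S₂) has least ℓ₁-norm among the solutions of Ax = Ax₀, and a
dual optimal solution of that program is the required ζ (`NSP.weakRSP`). -/

lemma lpN_one {ι : Type*} [Fintype ι] (v : ι → ℝ) : lpN 1 v = ∑ i, |v i| := by
  simp [lpN, PiLp.norm_eq_of_L1]

lemma lpN_top {ι : Type*} [Fintype ι] (v : ι → ℝ) : lpN ⊤ v = ‖v‖ := by
  simp [lpN]

lemma lpN_two_sq {ι : Type*} [Fintype ι] (v : ι → ℝ) : lpN 2 v ^ 2 = ∑ i, v i ^ 2 := by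
  rw [lpN, PiLp.norm_eq_of_L2, Real.sq_sqrt (Finset.sum_nonneg fun i _ => sq_nonneg _)]
  simp

lemma lpN_two_nonneg {ι : Type*} [Fintype ι] (v : ι → ℝ) : 0 ≤ lpN 2 v := norm_nonneg _

lemma lpN_top_nonneg {ι : Type*} [Fintype ι] (v : ι → ℝ) : 0 ≤ lpN ⊤ v := norm_nonneg _

lemma lpN_one_nonneg {ι : Type*} [Fintype ι] (v : ι → ℝ) : 0 ≤ lpN 1 v := norm_nonneg _

lemma abs_le_lpN_top {ι : Type*} [Fintype ι] (v : ι → ℝ) (i : ι) : |v i| ≤ lpN ⊤ v := by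
  rw [lpN_top]; exact norm_le_pi_norm v i

lemma lpN_top_le {ι : Type*} [Fintype ι] {v : ι → ℝ} {r : ℝ} (hr : 0 ≤ r) (h : ∀ i, |v i| ≤ r) :
    lpN ⊤ v ≤ r := by
  rw [lpN_top]; exact (pi_norm_le_iff_of_nonneg hr).2 h

lemma lpN_top_le_one {ι : Type*} [Fintype ι] (v : ι → ℝ) : lpN ⊤ v ≤ lpN 1 v := by
  refine lpN_top_le (lpN_one_nonneg v) fun i => ?_
  rw [lpN_one]
  exact Finset.single_le_sum (f := fun i => |v i|) (fun j _ => abs_nonneg _) (Finset.mem_univ i)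

lemma lpN_top_le_two {ι : Type*} [Fintype ι] (v : ι → ℝ) : lpN ⊤ v ≤ lpN 2 v := by
  refine lpN_top_le (lpN_two_nonneg v) fun i => ?_
  refine abs_le_of_sq_le_sq ?_ (lpN_two_nonneg v)
  rw [lpN_two_sq]
  exact Finset.single_le_sum (f := fun i => v i ^ 2) (fun j _ => sq_nonneg _) (Finset.mem_univ i)

lemma dotProduct_le_lpN {ι : Type*} [Fintype ι] (u v : ι → ℝ) :
    |u ⬝ᵥ v| ≤ lpN ⊤ u * ∑ i, |v i| := by
  rw [dotProduct, Finset.mul_sum]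
  refine (Finset.abs_sum_le_sum_abs _ _).trans (Finset.sum_le_sum fun i _ => ?_)
  rw [abs_mul]
  exact mul_le_mul_of_nonneg_right (abs_le_lpN_top u i) (abs_nonneg _)

/-! ### Finitely generated cones -/

section Cone

variable {ι E : Type*} [Fintype ι] [NormedAddCommGroup E] [NormedSpace ℝ E]

/-- Conic Carathéodory. -/
lemma exists_nonneg_linearIndepOn (a : ι → E) (x : ι → ℝ) (hx : 0 ≤ x) :
    ∃ x' : ι → ℝ, 0 ≤ x' ∧ ∑ i, x' i • a i = ∑ i, x i • a i ∧
      LinearIndepOn ℝ a {i | x' i ≠ 0} := by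
  classical
  induction hN : (Finset.univ.filter fun i => x i ≠ 0).card using Nat.strong_induction_on
    generalizing x with
  | _ N ih =>
    by_cases hli : LinearIndepOn ℝ a {i | x i ≠ 0}
    · exact ⟨x, hx, rfl, hli⟩
    have key : ∃ g : ι → ℝ, (∀ i, x i = 0 → g i = 0) ∧ ∑ i, g i • a i = 0 ∧ ∃ i, 0 < g i := by
      have hli' : ¬ LinearIndepOn ℝ a ((Finset.univ.filter fun i => x i ≠ 0 : Finset ι) : Set ι) := by
        simpa using hli
      rw [linearIndepOn_finset_iff] at hli'
      push Not at hli'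
      obtain ⟨g, hg, i, hi, hgi⟩ := hli'
      have hi' : x i ≠ 0 := by simpa using hi
      have h0 : ∑ i, (if x i = 0 then 0 else g i) • a i = 0 := by
        rw [← hg, Finset.sum_filter]
        refine Finset.sum_congr rfl fun j _ => ?_
        by_cases h : x j = 0 <;> simp [h]
      rcases lt_or_gt_of_ne hgi with h | h
      · refine ⟨fun i => -(if x i = 0 then 0 else g i), fun j hj => by simp [hj], ?_, i, ?_⟩
        · simp only [neg_smul, Finset.sum_neg_distrib, h0, neg_zero]
        · simpa [hi'] using h
      · exact ⟨fun i => if x i = 0 then 0 else g i, fun j hj => by simp [hj], h0, i,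
          by simpa [hi'] using h⟩
    obtain ⟨g, hgx, hg0, i₁, hi₁⟩ := key
    -- Ratio test: subtracting `c • g` for the least ratio `c` keeps every coefficient nonnegative,
    -- creates no new nonzero one and annihilates the one at `i₀`.
    obtain ⟨i₀, hi₀, hmin⟩ := Finset.exists_min_image (Finset.univ.filter fun i => 0 < g i)
      (fun i => x i / g i) ⟨i₁, by simpa using hi₁⟩
    have hgi₀ : 0 < g i₀ := by simpa using hi₀
    set c := x i₀ / g i₀ with hc
    have hc0 : 0 ≤ c := div_nonneg (hx i₀) hgi₀.le
    have hx' : 0 ≤ fun i => x i - c * g i := by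
      intro i
      simp only [Pi.zero_apply, sub_nonneg]
      rcases lt_or_ge 0 (g i) with h | h
      · have := hmin i (by simpa using h)
        exact (le_div_iff₀ h).1 this
      · exact (mul_nonpos_of_nonneg_of_nonpos hc0 h).trans (hx i)
    have hcard : (Finset.univ.filter fun i => x i - c * g i ≠ 0).card < N := by
      rw [← hN]
      refine Finset.card_lt_card (Finset.ssubset_iff_of_subset ?_ |>.2 ⟨i₀, ?_, ?_⟩)
      · intro i
        simp only [Finset.mem_filter, Finset.mem_univ, true_and]
        intro h h'
        exact h (by simp [h', hgx i h'])
      · simp only [Finset.mem_filter, Finset.mem_univ, true_and]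
        intro h
        exact hgi₀.ne' (hgx _ h)
      · simp [hc, div_mul_cancel₀ _ hgi₀.ne']
    obtain ⟨x', h1, h2, h3⟩ := ih _ hcard _ hx' rfl
    refine ⟨x', h1, h2.trans ?_, h3⟩
    simp only [sub_smul, Finset.sum_sub_distrib, mul_smul, ← Finset.smul_sum, hg0, smul_zero,
      sub_zero]

lemma exists_bound_of_linearIndepOn [FiniteDimensional ℝ E] (a : ι → E) (s : Set ι)
    (hs : LinearIndepOn ℝ a s) :
    ∃ C : ℝ, 0 ≤ C ∧ ∀ x : ι → ℝ, (∀ i, x i ≠ 0 → i ∈ s) → ∀ i, |x i| ≤ C * ‖∑ i, x i • a i‖ := by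
  classical
  have hinj : LinearMap.ker (Fintype.linearCombination ℝ (fun i : s => a i)) = ⊥ := by
    rw [LinearMap.ker_eq_bot]
    exact hs.fintypeLinearCombination_injective
  obtain ⟨K, -, hK⟩ := LinearMap.exists_antilipschitzWith _ hinj
  refine ⟨K, K.2, fun x hx i => ?_⟩
  by_cases hi : x i = 0
  · rw [hi, abs_zero]; positivity
  have h1 := hK.le_mul_norm (map_zero _) (fun j : s => x j)
  have h2 : Fintype.linearCombination ℝ (fun i : s => a i) (fun j : s => x j)
      = ∑ i, x i • a i := by
    rw [Fintype.linearCombination_apply]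
    rw [← Finset.sum_subtype (Finset.univ.filter (· ∈ s)) (by simp) (fun i => x i • a i),
      Finset.sum_filter_of_ne]
    intro i _ h
    exact hx i fun h' => h (by simp [h'])
  rw [h2] at h1
  exact (norm_le_pi_norm (fun j : s => x j) ⟨i, hx i hi⟩).trans h1

/-- Carathéodory reduces to linearly independent subfamilies, on each of which the coefficients are
controlled by the norm of the sum. There are finitely many subfamilies, so the sum of their
constants serves for all. -/
lemma exists_nonneg_bound [FiniteDimensional ℝ E] (a : ι → E) :
    ∃ C : ℝ, 0 ≤ C ∧ ∀ x : ι → ℝ, 0 ≤ x → ∃ x' : ι → ℝ, 0 ≤ x' ∧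
      ∑ i, x' i • a i = ∑ i, x i • a i ∧ ∀ i, x' i ≤ C * ‖∑ i, x i • a i‖ := by
  classical
  have h : ∀ s : Set ι, ∃ C : ℝ, 0 ≤ C ∧ (LinearIndepOn ℝ a s → ∀ x : ι → ℝ,
      (∀ i, x i ≠ 0 → i ∈ s) → ∀ i, |x i| ≤ C * ‖∑ i, x i • a i‖) := by
    intro s
    by_cases hs : LinearIndepOn ℝ a s
    · obtain ⟨C, h0, h1⟩ := exists_bound_of_linearIndepOn a s hs
      exact ⟨C, h0, fun _ => h1⟩
    · exact ⟨0, le_rfl, fun h => absurd h hs⟩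
  choose C hC0 hC using h
  refine ⟨∑ s, C s, Finset.sum_nonneg fun s _ => hC0 s, fun x hx => ?_⟩
  obtain ⟨x', h1, h2, h3⟩ := exists_nonneg_linearIndepOn a x hx
  refine ⟨x', h1, h2, fun i => ?_⟩
  have h4 := hC _ h3 x' (fun i hi => hi) i
  rw [h2] at h4
  refine (le_abs_self _).trans (h4.trans (mul_le_mul_of_nonneg_right ?_ (norm_nonneg _)))
  exact Finset.single_le_sum (fun s _ => hC0 s) (Finset.mem_univ _)

/-- Cone points in the unit ball around `v` have coefficients in one fixed box, whose image is
compact and therefore contains every limit of such points. -/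
lemma isClosed_cone [FiniteDimensional ℝ E] (a : ι → E) :
    IsClosed {v : E | ∃ x : ι → ℝ, 0 ≤ x ∧ ∑ i, x i • a i = v} := by
  obtain ⟨C, hC0, hC⟩ := exists_nonneg_bound a
  refine isClosed_of_closure_subset fun v hv => ?_
  set I : Set E := (fun x : ι → ℝ => ∑ i, x i • a i) '' Set.Icc 0 (fun _ => C * (‖v‖ + 1))
  have hI : IsClosed I := (isCompact_Icc.image (by fun_prop)).isClosed
  have hsub : Metric.ball v 1 ∩ {v : E | ∃ x : ι → ℝ, 0 ≤ x ∧ ∑ i, x i • a i = v} ⊆ I := by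
    rintro w ⟨hw, x, hx, rfl⟩
    obtain ⟨x', h1, h2, h3⟩ := hC x hx
    refine ⟨x', ⟨h1, fun i => (h3 i).trans (mul_le_mul_of_nonneg_left ?_ hC0)⟩, h2⟩
    rw [Metric.mem_ball, dist_eq_norm] at hw
    have := norm_le_norm_add_norm_sub v (∑ i, x i • a i)
    rw [norm_sub_rev] at this
    linarith
  have hvI : v ∈ I := by
    rw [← hI.closure_eq]
    exact closure_mono hsub (Metric.isOpen_ball.inter_closure ⟨Metric.mem_ball_self one_pos, hv⟩)
  obtain ⟨x, hx, h⟩ := hvI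
  exact ⟨x, hx.1, h⟩

/-- Farkas' lemma for the cone generated by finitely many vectors. -/
lemma farkas [FiniteDimensional ℝ E] (a : ι → E) (b : E)
    (h : ∀ f : E →L[ℝ] ℝ, (∀ i, f (a i) ≤ 0) → f b ≤ 0) :
    ∃ x : ι → ℝ, 0 ≤ x ∧ ∑ i, x i • a i = b := by
  classical
  by_contra hb
  have hconv : Convex ℝ {v : E | ∃ x : ι → ℝ, 0 ≤ x ∧ ∑ i, x i • a i = v} := by
    rintro _ ⟨x, hx, rfl⟩ _ ⟨x', hx', rfl⟩ s t hs ht -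
    refine ⟨s • x + t • x', add_nonneg (smul_nonneg hs hx) (smul_nonneg ht hx'), ?_⟩
    simp only [Pi.add_apply, Pi.smul_apply, add_smul, Finset.sum_add_distrib, Finset.smul_sum,
      smul_eq_mul, mul_smul]
  obtain ⟨f, u, hf, hu⟩ := geometric_hahn_banach_closed_point hconv (isClosed_cone a) hb
  have hu0 : 0 < u := by simpa using hf 0 ⟨0, le_rfl, by simp⟩
  have hle : ∀ i, f (a i) ≤ 0 := by
    intro i
    -- `f` stays below `u` on the cone, but a generator with `f (a i) > 0` has a nonnegative
    -- multiple on which `f` equals `u`.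
    by_contra! hi
    have := hf ((u / f (a i)) • a i) ⟨Pi.single i (u / f (a i)), ?_, ?_⟩
    · rw [map_smul, smul_eq_mul, div_mul_cancel₀ _ hi.ne'] at this
      exact lt_irrefl _ this
    · exact Pi.single_nonneg.2 (div_pos hu0 hi).le
    · rw [Finset.sum_eq_single i]
      · simp
      · intro j _ hj; simp [hj]
      · simp
  linarith [h f hle]

end Cone

/-! ### Optimality conditions for linear programs -/

section LP

variable {R₁ R₂ L : Type*} [Fintype R₁] [Fintype R₂] [Fintype L]

/-- Farkas for the active rows of `B₁` and the rows of `± B₂`; inactive rows are replaced by 0 to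
keep the index type. A functional violating the Farkas condition would be a direction along which
`z` can move a little, staying feasible (inactive rows keep their slack) and decreasing `g`. -/
lemma exists_multipliers (B₁ : Matrix R₁ L ℝ) (B₂ : Matrix R₂ L ℝ) (d₁ : R₁ → ℝ) (d₂ : R₂ → ℝ)
    (z g : L → ℝ) (hz₁ : B₁ *ᵥ z ≤ d₁) (hz₂ : B₂ *ᵥ z = d₂)
    (hg : ∀ z', B₁ *ᵥ z' ≤ d₁ → B₂ *ᵥ z' = d₂ → g ⬝ᵥ z ≤ g ⬝ᵥ z') :
    ∃ (p : R₁ → ℝ) (r : R₂ → ℝ), 0 ≤ p ∧ p ᵥ* B₁ + r ᵥ* B₂ = -g ∧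
      ∀ i, p i ≠ 0 → (B₁ *ᵥ z) i = d₁ i := by
  classical
  let a : R₁ ⊕ R₂ ⊕ R₂ → L → ℝ :=
    Sum.elim (fun i => if (B₁ *ᵥ z) i = d₁ i then B₁ i else 0) (Sum.elim (fun j => B₂ j)
      (fun j => -B₂ j))
  obtain ⟨x, hx0, hx⟩ := farkas a (-g) (by
    intro f hf
    set d : L → ℝ := fun l => f (Pi.single l 1) with hd
    have hfd : ∀ v, f v = v ⬝ᵥ d := by
      intro v
      conv_lhs => rw [pi_eq_sum_univ' v]
      simp [dotProduct, hd]
    by_contra! hlt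
    have h1 : ∀ i, (B₁ *ᵥ z) i = d₁ i → (B₁ *ᵥ d) i ≤ 0 := by
      intro i hi
      have := hf (Sum.inl i)
      simp only [a, Sum.elim_inl, if_pos hi, hfd] at this
      exact this
    have h2 : B₂ *ᵥ d = 0 := by
      ext j
      have h3 := hf (Sum.inr (Sum.inl j))
      have h4 := hf (Sum.inr (Sum.inr j))
      simp only [a, Sum.elim_inr, Sum.elim_inl, hfd, neg_dotProduct] at h3 h4
      exact le_antisymm h3 (neg_nonpos.1 h4)
    have hev : ∀ᶠ ε : ℝ in nhdsWithin 0 (Set.Ioi 0), ∀ i, (B₁ *ᵥ (z + ε • d)) i ≤ d₁ i := by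
      rw [Filter.eventually_all]
      intro i
      simp only [Matrix.mulVec_add, Matrix.mulVec_smul, Pi.add_apply, Pi.smul_apply, smul_eq_mul]
      rcases eq_or_lt_of_le (hz₁ i) with h | h
      · filter_upwards [self_mem_nhdsWithin] with ε hε
        have := mul_nonpos_of_nonneg_of_nonpos (le_of_lt hε) (h1 i h)
        linarith
      · apply nhdsWithin_le_nhds
        have hcont : Filter.Tendsto (fun ε : ℝ => (B₁ *ᵥ z) i + ε * (B₁ *ᵥ d) i) (nhds 0)
            (nhds ((B₁ *ᵥ z) i + 0 * (B₁ *ᵥ d) i)) := by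
          apply Continuous.tendsto; fun_prop
        filter_upwards [hcont.eventually_lt_const (u := d₁ i) (by simpa using h)] with ε hε
        exact hε.le
    obtain ⟨ε, hε, hε0⟩ := (hev.and self_mem_nhdsWithin).exists
    have h5 := hg (z + ε • d) hε (by simp [Matrix.mulVec_add, Matrix.mulVec_smul, h2, hz₂])
    rw [dotProduct_add, dotProduct_smul, smul_eq_mul] at h5
    rw [hfd, neg_dotProduct] at hlt
    have : ε * (g ⬝ᵥ d) < 0 := mul_neg_of_pos_of_neg hε0 (by linarith)
    linarith)
  refine ⟨fun i => if (B₁ *ᵥ z) i = d₁ i then x (Sum.inl i) else 0,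
    fun j => x (Sum.inr (Sum.inl j)) - x (Sum.inr (Sum.inr j)), ?_, ?_, ?_⟩
  · intro i
    dsimp only
    split_ifs
    · exact hx0 _
    · exact le_rfl
  · rw [← hx]
    ext l
    simp only [Fintype.sum_sum_type, a, Sum.elim_inl, Sum.elim_inr, Pi.add_apply, Finset.sum_apply,
      Pi.smul_apply, smul_eq_mul, Matrix.vecMul, dotProduct, Pi.neg_apply, sub_mul,
      Finset.sum_sub_distrib, mul_neg, Finset.sum_neg_distrib]
    rw [sub_eq_add_neg]
    congr 1
    refine Finset.sum_congr rfl fun i _ => ?_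
    split_ifs <;> simp
  · intro i hi
    by_contra h
    simp [h] at hi

end LP

/-! ### Robinson's constant and the distance to a polyhedron -/

section Robinson

/-- Without boundedness the `sSup` in `hoffmanMu` would not dominate its members. Solvable
right-hand sides form the cone generated by the columns, their negatives and the slack unit vectors,
so `exists_nonneg_bound` gives a solution whose entries are differences of two numbers in [0, C]. -/
lemma bddAbove_hoffmanMu {P₁ P₂ Q : Type*} [Fintype P₁] [Fintype P₂] [Fintype Q]
    (M' : Matrix P₁ Q ℝ) (M'' : Matrix P₂ Q ℝ) :
    BddAbove {r | ∃ (d' : P₁ → ℝ) (d'' : P₂ → ℝ),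
      (∃ u : Q → ℝ, M' *ᵥ u ≤ d' ∧ M'' *ᵥ u = d'') ∧ lpN 2 (Sum.elim d' d'') ≤ 1 ∧
      r = sInf {s | ∃ u : Q → ℝ, M' *ᵥ u ≤ d' ∧ M'' *ᵥ u = d'' ∧ s = lpN ⊤ u}} := by
  classical
  let a : Q ⊕ Q ⊕ P₁ → (P₁ ⊕ P₂ → ℝ) :=
    Sum.elim (fun j => Sum.elim (fun i => M' i j) (fun i => M'' i j))
      (Sum.elim (fun j => -Sum.elim (fun i => M' i j) (fun i => M'' i j))
        (fun i => Pi.single (Sum.inl i) 1))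
  have hal : ∀ (x : Q ⊕ Q ⊕ P₁ → ℝ) i, (∑ k, x k • a k) (Sum.inl i) =
      (M' *ᵥ fun j => x (Sum.inl j) - x (Sum.inr (Sum.inl j))) i + x (Sum.inr (Sum.inr i)) := by
    intro x i
    simp only [Fintype.sum_sum_type, a, Sum.elim_inl, Sum.elim_inr, Finset.sum_apply,
      Pi.smul_apply, smul_eq_mul, Matrix.mulVec, dotProduct, Pi.neg_apply, mul_sub,
      Finset.sum_sub_distrib, mul_neg, Finset.sum_neg_distrib]
    simp [Pi.single_apply, mul_comm]
    ring
  have har : ∀ (x : Q ⊕ Q ⊕ P₁ → ℝ) i, (∑ k, x k • a k) (Sum.inr i) =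
      (M'' *ᵥ fun j => x (Sum.inl j) - x (Sum.inr (Sum.inl j))) i := by
    intro x i
    simp only [Fintype.sum_sum_type, a, Sum.elim_inl, Sum.elim_inr, Finset.sum_apply,
      Pi.smul_apply, smul_eq_mul, Matrix.mulVec, dotProduct, Pi.neg_apply, mul_sub,
      Finset.sum_sub_distrib, mul_neg, Finset.sum_neg_distrib]
    simp [mul_comm]
    ring
  obtain ⟨C, hC0, hC⟩ := exists_nonneg_bound a
  refine ⟨C, ?_⟩
  rintro r ⟨d', d'', ⟨u, hu', hu''⟩, hd, rfl⟩
  let x : Q ⊕ Q ⊕ P₁ → ℝ := Sum.elim (fun j => max (u j) 0)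
    (Sum.elim (fun j => max (-u j) 0) (fun i => d' i - (M' *ᵥ u) i))
  have hx0 : 0 ≤ x := by
    rintro (j | j | i)
    · exact le_max_right _ _
    · exact le_max_right _ _
    · exact sub_nonneg.2 (hu' i)
  have hxu : (fun j => x (Sum.inl j) - x (Sum.inr (Sum.inl j))) = u := by
    ext j
    simp only [x, Sum.elim_inl, Sum.elim_inr]
    rcases le_total (u j) 0 with h | h
    · rw [max_eq_right h, max_eq_left (by linarith)]; ring
    · rw [max_eq_left h, max_eq_right (by linarith)]; ring
  have hx : ∑ k, x k • a k = Sum.elim d' d'' := by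
    ext (i | i)
    · rw [hal, hxu]; simp [x]
    · rw [har, hxu, hu'']; simp
  obtain ⟨x', h0, h1, h2⟩ := hC x hx0
  have hle : C * ‖∑ k, x k • a k‖ ≤ C := by
    rw [hx, ← lpN_top]
    exact mul_le_of_le_one_right hC0 ((lpN_top_le_two _).trans hd)
  set u' : Q → ℝ := fun j => x' (Sum.inl j) - x' (Sum.inr (Sum.inl j)) with hu'def
  have hu1 : M' *ᵥ u' ≤ d' := by
    intro i
    have := hal x' i
    rw [h1, hx, Sum.elim_inl] at this
    have h3 := h0 (Sum.inr (Sum.inr i))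
    simp only [Pi.zero_apply] at h3
    linarith
  have hu2 : M'' *ᵥ u' = d'' := by
    ext i
    rw [← har x', h1, hx, Sum.elim_inr]
  refine csInf_le_of_le ⟨0, ?_⟩ ⟨u', hu1, hu2, rfl⟩ (lpN_top_le hC0 fun j => ?_)
  · rintro _ ⟨u, -, -, rfl⟩
    exact lpN_top_nonneg u
  · have h3 := h0 (Sum.inl j)
    have h4 := h0 (Sum.inr (Sum.inl j))
    have h5 := h2 (Sum.inl j)
    have h6 := h2 (Sum.inr (Sum.inl j))
    simp only [Pi.zero_apply] at h3 h4
    rw [abs_le]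
    constructor <;> simp only [hu'def] <;> linarith

lemma hoffmanMu_nonneg {P₁ P₂ Q : Type*} [Fintype P₁] [Fintype P₂] [Fintype Q]
    (M' : Matrix P₁ Q ℝ) (M'' : Matrix P₂ Q ℝ) : 0 ≤ hoffmanMu ⊤ 2 M' M'' := by
  apply Real.sSup_nonneg
  rintro _ ⟨d', d'', -, -, rfl⟩
  apply Real.sInf_nonneg
  rintro _ ⟨u, -, -, rfl⟩
  exact lpN_top_nonneg u

lemma robinson_nonneg {R₁ R₂ L : Type*} [Fintype R₁] [DecidableEq R₁] [Fintype R₂] [Fintype L]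
    (M₁ : Matrix R₁ L ℝ) (M₂ : Matrix R₂ L ℝ) : 0 ≤ robinson ⊤ 2 M₁ M₂ :=
  Real.iSup_nonneg fun _ => hoffmanMu_nonneg _ _

/-- The variational inequality of the Euclidean projection, phrased as linear optimality of `z'` on
the polyhedron so that `exists_multipliers` applies. -/
lemma exists_projection {R₁ R₂ L : Type*} [Fintype L] (M₁ : Matrix R₁ L ℝ) (M₂ : Matrix R₂ L ℝ)
    (d₁ : R₁ → ℝ) (d₂ : R₂ → ℝ)
    (hne : ∃ z, M₁ *ᵥ z ≤ d₁ ∧ M₂ *ᵥ z = d₂) (z : L → ℝ) :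
    ∃ z', (M₁ *ᵥ z' ≤ d₁ ∧ M₂ *ᵥ z' = d₂) ∧
      ∀ w, M₁ *ᵥ w ≤ d₁ → M₂ *ᵥ w = d₂ → (z' - z) ⬝ᵥ z' ≤ (z' - z) ⬝ᵥ w := by
  let K : Set (EuclideanSpace ℝ L) := {w | M₁ *ᵥ w.ofLp ≤ d₁ ∧ M₂ *ᵥ w.ofLp = d₂}
  have hK : Convex ℝ K := by
    rintro v ⟨hv1, hv2⟩ w ⟨hw1, hw2⟩ s t hs ht hst
    refine ⟨fun i => ?_, ?_⟩
    · have h1 := mul_le_mul_of_nonneg_left (hv1 i) hs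
      have h2 := mul_le_mul_of_nonneg_left (hw1 i) ht
      simp only [WithLp.ofLp_add, WithLp.ofLp_smul, Matrix.mulVec_add, Matrix.mulVec_smul,
        Pi.add_apply, Pi.smul_apply, smul_eq_mul]
      calc _ ≤ s * d₁ i + t * d₁ i := add_le_add h1 h2
        _ = d₁ i := by rw [← add_mul, hst, one_mul]
    · simp only [WithLp.ofLp_add, WithLp.ofLp_smul, Matrix.mulVec_add, Matrix.mulVec_smul, hv2,
        hw2, ← add_smul, hst, one_smul]
  have hKc : IsClosed K := by
    have h : Continuous fun w : EuclideanSpace ℝ L => w.ofLp := PiLp.continuous_ofLp 2 _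
    exact (isClosed_le (continuous_const.matrix_mulVec h) continuous_const).inter
      (isClosed_eq (continuous_const.matrix_mulVec h) continuous_const)
  obtain ⟨z₀, hz₀⟩ := hne
  obtain ⟨v, hvK, hv⟩ := exists_norm_eq_iInf_of_complete_convex (K := K)
    ⟨WithLp.toLp 2 z₀, hz₀⟩ hKc.isComplete hK (WithLp.toLp 2 z)
  rw [norm_eq_iInf_iff_real_inner_le_zero hK hvK] at hv
  refine ⟨v.ofLp, hvK, fun w hw1 hw2 => ?_⟩
  have := hv (WithLp.toLp 2 w) ⟨hw1, hw2⟩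
  rw [EuclideanSpace.inner_eq_star_dotProduct] at this
  simp only [WithLp.ofLp_sub, star_trivial] at this
  rw [dotProduct_comm, sub_dotProduct, dotProduct_sub, dotProduct_sub] at this
  rw [sub_dotProduct, sub_dotProduct]
  linarith

/-- Hoffman's error bound with Robinson's constant. -/
theorem exists_lpN_sub_le_robinson {R₁ R₂ L : Type*} [Fintype R₁] [DecidableEq R₁] [Fintype R₂]
    [Fintype L] (M₁ : Matrix R₁ L ℝ) (M₂ : Matrix R₂ L ℝ) (d₁ : R₁ → ℝ)
    (d₂ : R₂ → ℝ) (hne : ∃ z, M₁ *ᵥ z ≤ d₁ ∧ M₂ *ᵥ z = d₂) (z : L → ℝ) :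
    ∃ z', (M₁ *ᵥ z' ≤ d₁ ∧ M₂ *ᵥ z' = d₂) ∧ lpN 2 (z - z') ≤ robinson ⊤ 2 M₁ M₂ *
      (∑ i, max ((M₁ *ᵥ z) i - d₁ i) 0 + ∑ j, |(M₂ *ᵥ z) j - d₂ j|) := by
  obtain ⟨z', ⟨hz1, hz2⟩, hproj⟩ := exists_projection M₁ M₂ d₁ d₂ hne z
  refine ⟨z', ⟨hz1, hz2⟩, ?_⟩
  set res := ∑ i, max ((M₁ *ᵥ z) i - d₁ i) 0 + ∑ j, |(M₂ *ᵥ z) j - d₂ j| with hres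
  have hres0 : 0 ≤ res := add_nonneg (Finset.sum_nonneg fun _ _ => le_max_right _ _)
    (Finset.sum_nonneg fun _ _ => abs_nonneg _)
  obtain ⟨p, r, hp0, hpr, hact⟩ := exists_multipliers M₁ M₂ d₁ d₂ z' (z' - z) hz1 hz2 hproj
  rw [neg_sub] at hpr
  set ρ := lpN 2 (z - z') with hρ
  rcases eq_or_lt_of_le (lpN_two_nonneg (z - z')) with h0 | hpos
  · rw [hρ, ← h0]; exact mul_nonneg (robinson_nonneg _ _) hres0
  rw [← hρ] at hpos
  -- With this `S` and d' = 0, the inequalities in `hoffmanMu` say that `u` is nonnegative on the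
  -- inequality rows and vanishes wherever `p` does, hence on all inactive rows.
  let S : Finset R₁ := Finset.univ.filter fun i => p i = 0
  have hmem : ∀ i, i ∈ S ↔ p i = 0 := by simp [S]
  set N' := Matrix.fromBlocks
        ((1 : Matrix R₁ R₁ ℝ).submatrix (Subtype.val : {i // i ∈ S} → R₁) id)
        (0 : Matrix {i // i ∈ S} R₂ ℝ) (-1 : Matrix R₁ R₁ ℝ) (0 : Matrix R₁ R₂ ℝ) with hN'
  set N'' := (Matrix.fromRows M₁ M₂)ᵀ with hN''
  have hN'u : ∀ u : R₁ ⊕ R₂ → ℝ, N' *ᵥ u ≤ 0 ↔ (∀ i, p i = 0 → u (Sum.inl i) = 0) ∧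
      ∀ i, 0 ≤ u (Sum.inl i) := by
    intro u
    have h1 : ∀ i : {i // i ∈ S}, (N' *ᵥ u) (Sum.inl i) = u (Sum.inl i) := by
      intro i
      simp [hN', Matrix.mulVec, dotProduct, Matrix.one_apply]
    have h2 : ∀ i, (N' *ᵥ u) (Sum.inr i) = -u (Sum.inl i) := by
      intro i
      simp [hN', Matrix.mulVec, dotProduct, Matrix.one_apply]
    constructor
    · intro h
      have h3 : ∀ i, 0 ≤ u (Sum.inl i) := fun i => by
        have := h (Sum.inr i)
        rw [h2] at this
        simpa using this
      refine ⟨fun i hi => le_antisymm ?_ (h3 i), h3⟩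
      have := h (Sum.inl ⟨i, (hmem i).2 hi⟩)
      rw [h1] at this
      simpa using this
    · rintro ⟨h3, h4⟩ (i | i)
      · rw [h1, h3 _ ((hmem _).1 i.2)]; rfl
      · rw [h2]; simpa using h4 i
  have hN''u : ∀ u : R₁ ⊕ R₂ → ℝ,
      N'' *ᵥ u = (fun i => u (Sum.inl i)) ᵥ* M₁ + (fun j => u (Sum.inr j)) ᵥ* M₂ := by
    intro u
    rw [hN'', Matrix.mulVec_transpose]
    ext l
    simp [Matrix.vecMul, dotProduct]
  set d'' : L → ℝ := ρ⁻¹ • (z - z') with hd''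
  have hsq : (z - z') ⬝ᵥ (z - z') = ρ ^ 2 := by
    rw [hρ, lpN_two_sq, dotProduct]
    exact Finset.sum_congr rfl fun i _ => (sq _).symm
  have hd1 : lpN 2 (Sum.elim (0 : {i // i ∈ S} ⊕ R₁ → ℝ) d'') ≤ 1 := by
    rw [← abs_of_nonneg (lpN_two_nonneg _), ← sq_le_one_iff_abs_le_one, lpN_two_sq,
      Fintype.sum_sum_type]
    have : ∑ i, d'' i ^ 2 = ρ⁻¹ ^ 2 * ρ ^ 2 := by
      rw [← hsq, dotProduct, Finset.mul_sum]
      refine Finset.sum_congr rfl fun i _ => ?_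
      simp only [hd'', Pi.smul_apply, smul_eq_mul]; ring
    simp only [Sum.elim_inl, Sum.elim_inr, Pi.zero_apply, this]
    rw [← mul_pow, inv_mul_cancel₀ hpos.ne']
    simp
  -- Pair `N'' *ᵥ u = d''` with `z - z'`: on the support of `u` the rows are active at `z'`, so each
  -- term is at most `lpN ⊤ u` times a residual. This holds for every admissible `u`, hence for the
  -- infimum of the norms; `(p, r) / ρ` only shows that the system is solvable.
  have hfeas : ∀ u : R₁ ⊕ R₂ → ℝ, N' *ᵥ u ≤ 0 → N'' *ᵥ u = d'' → ρ ≤ lpN ⊤ u * res := by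
    intro u hu1 hu2
    obtain ⟨h3, h4⟩ := (hN'u u).1 hu1
    have hb : ∀ k, |u k| ≤ lpN ⊤ u := abs_le_lpN_top u
    have e1 : ρ = (N'' *ᵥ u) ⬝ᵥ (z - z') := by
      rw [hu2, hd'', smul_dotProduct, hsq, smul_eq_mul]
      field_simp
    rw [e1, hN''u, add_dotProduct, ← Matrix.dotProduct_mulVec, ← Matrix.dotProduct_mulVec,
      Matrix.mulVec_sub, Matrix.mulVec_sub, hz2, hres, mul_add, Finset.mul_sum, Finset.mul_sum]
    refine add_le_add (Finset.sum_le_sum fun i _ => ?_) (Finset.sum_le_sum fun j _ => ?_)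
    · by_cases hi : p i = 0
      · simp only [h3 i hi, zero_mul]
        exact mul_nonneg (lpN_top_nonneg _) (le_max_right _ _)
      · rw [Pi.sub_apply, hact i hi]
        refine (mul_le_mul_of_nonneg_left (le_max_left _ 0) (h4 i)).trans
          (mul_le_mul_of_nonneg_right ((le_abs_self _).trans (hb _)) (le_max_right _ _))
    · rw [Pi.sub_apply]
      refine (le_abs_self _).trans ?_
      rw [abs_mul]
      exact mul_le_mul_of_nonneg_right (hb _) (abs_nonneg _)
  let u₀ : R₁ ⊕ R₂ → ℝ := Sum.elim (ρ⁻¹ • p) (ρ⁻¹ • r)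
  have hu01 : N' *ᵥ u₀ ≤ 0 := by
    rw [hN'u]
    exact ⟨fun i hi => by simp [u₀, hi],
      fun i => mul_nonneg (inv_nonneg.2 hpos.le) (hp0 i)⟩
  have hu02 : N'' *ᵥ u₀ = d'' := by
    rw [hN''u]
    change (ρ⁻¹ • p) ᵥ* M₁ + (ρ⁻¹ • r) ᵥ* M₂ = d''
    rw [Matrix.smul_vecMul, Matrix.smul_vecMul, ← smul_add, hpr]
  set m := sInf {s | ∃ u : R₁ ⊕ R₂ → ℝ, N' *ᵥ u ≤ 0 ∧ N'' *ᵥ u = d'' ∧ s = lpN ⊤ u} with hm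
  have hmle : m ≤ robinson ⊤ 2 M₁ M₂ := by
    refine le_trans ?_ (le_ciSup (Set.finite_range _).bddAbove S)
    exact le_csSup (bddAbove_hoffmanMu N' N'') ⟨0, d'', ⟨u₀, hu01, hu02⟩, hd1, rfl⟩
  have hrespos : 0 < res := by
    by_contra! h
    have := hfeas u₀ hu01 hu02
    have h' := mul_nonpos_of_nonneg_of_nonpos (lpN_top_nonneg u₀) h
    linarith
  rw [← div_le_iff₀ hrespos]
  refine le_trans ?_ hmle
  refine le_csInf ⟨_, u₀, hu01, hu02, rfl⟩ ?_
  rintro _ ⟨u, hu1, hu2, rfl⟩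
  rw [div_le_iff₀ hrespos]
  exact hfeas u hu1 hu2

end Robinson

/-! ### Largest entries -/

/-- A set of at most `k` largest values of `f` on `U`, with a threshold `θ`. -/
lemma exists_top {ι : Type*} (U : Finset ι) (f : ι → ℝ) (hf : ∀ i, 0 ≤ f i) (k : ℕ) :
    ∃ T ⊆ U, T.card ≤ k ∧ ∃ θ : ℝ, 0 ≤ θ ∧ (∀ i ∈ T, θ ≤ f i) ∧ (∀ i ∈ U, i ∉ T → f i ≤ θ) ∧
      θ * T.card = θ * k := by
  classical
  have key : ∃ T ⊆ U, (T = U ∧ T.card ≤ k ∨ T.card = k) ∧ ∀ i ∈ T, ∀ j ∈ U, j ∉ T → f j ≤ f i := by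
    induction k with
    | zero => exact ⟨∅, by simp⟩
    | succ k ih =>
      obtain ⟨T, hTU, hc, hT⟩ := ih
      by_cases hne : T = U
      · refine ⟨T, hTU, Or.inl ⟨hne, ?_⟩, hT⟩
        rcases hc with hc | hc <;> omega
      have hk : T.card = k := by
        rcases hc with hc | hc
        · exact absurd hc.1 hne
        · exact hc
      have hnon : (U \ T).Nonempty := by
        rw [Finset.sdiff_nonempty]
        exact fun h => hne (Finset.Subset.antisymm hTU h)
      obtain ⟨j, hj, hmax⟩ := Finset.exists_max_image (U \ T) f hnon
      rw [Finset.mem_sdiff] at hj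
      refine ⟨insert j T, Finset.insert_subset hj.1 hTU,
        Or.inr (by rw [Finset.card_insert_of_notMem hj.2, hk]), ?_⟩
      intro i hi l hl hlT
      rw [Finset.mem_insert, not_or] at hlT
      rcases Finset.mem_insert.1 hi with rfl | hi
      · exact hmax l (Finset.mem_sdiff.2 ⟨hl, hlT.2⟩)
      · exact hT i hi l hl hlT.2
  obtain ⟨T, hTU, hc, hT⟩ := key
  by_cases hne : T = U
  -- If `U` is exhausted, it may have fewer than `k` elements; the threshold 0 then still gives `θ *
  -- T.card = θ * k`.
  · refine ⟨T, hTU, by rcases hc with hc | hc <;> omega, 0, le_rfl, fun i _ => hf i, ?_, by simp⟩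
    intro i hi hi'
    exact absurd (hne ▸ hi) hi'
  have hk : T.card = k := by
    rcases hc with hc | hc
    · exact absurd hc.1 hne
    · exact hc
  have hnon : (U \ T).Nonempty := by
    rw [Finset.sdiff_nonempty]
    exact fun h => hne (Finset.Subset.antisymm hTU h)
  obtain ⟨j, hj, hmax⟩ := Finset.exists_max_image (U \ T) f hnon
  rw [Finset.mem_sdiff] at hj
  exact ⟨T, hTU, hk.le, f j, hf j, fun i hi => hT i hi j hj.1 hj.2,
    fun i hi hiT => hmax i (Finset.mem_sdiff.2 ⟨hi, hiT⟩), by rw [hk]⟩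

/-- Over weights in [0, β] of total at most kβ, a linear functional with nonnegative coefficients is
largest when the full weight β sits on the top set: moving mass from `U \ T` to `T` across the
threshold θ loses nothing. -/
lemma sum_mul_le_of_top {ι : Type*} {U T : Finset ι} {f w : ι → ℝ} {k : ℕ} {θ β : ℝ} (hTU : T ⊆ U)
    (hθ : 0 ≤ θ) (hT : ∀ i ∈ T, θ ≤ f i) (hU : ∀ i ∈ U, i ∉ T → f i ≤ θ)
    (hc : θ * T.card = θ * k) (hw0 : ∀ i ∈ U, 0 ≤ w i) (hw : ∀ i ∈ U, w i ≤ β)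
    (hsum : ∑ i ∈ U, w i ≤ k * β) : ∑ i ∈ U, f i * w i ≤ β * ∑ i ∈ T, f i := by
  classical
  rw [← Finset.sum_sdiff hTU] at hsum ⊢
  have h1 : ∑ i ∈ U \ T, f i * w i ≤ θ * ∑ i ∈ U \ T, w i := by
    rw [Finset.mul_sum]
    refine Finset.sum_le_sum fun i hi => ?_
    rw [Finset.mem_sdiff] at hi
    exact mul_le_mul_of_nonneg_right (hU i hi.1 hi.2) (hw0 i hi.1)
  have h2 : θ * ∑ i ∈ T, (β - w i) ≤ ∑ i ∈ T, f i * (β - w i) := by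
    rw [Finset.mul_sum]
    exact Finset.sum_le_sum fun i hi =>
      mul_le_mul_of_nonneg_right (hT i hi) (sub_nonneg.2 (hw i (hTU hi)))
  simp only [mul_sub, Finset.sum_sub_distrib, Finset.sum_const, nsmul_eq_mul,
    ← Finset.sum_mul] at h2
  have h3 := mul_le_mul_of_nonneg_left hsum hθ
  have h4 : θ * (T.card * β) = θ * (k * β) := by rw [← mul_assoc, hc, mul_assoc]
  linarith [mul_comm β (∑ i ∈ T, f i)]

lemma sum_le_sum_of_top {ι : Type*} [Fintype ι] {T S : Finset ι} {f : ι → ℝ} {k : ℕ} {θ : ℝ}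
    (hθ : 0 ≤ θ) (hT : ∀ i ∈ T, θ ≤ f i) (hU : ∀ i ∈ Finset.univ, i ∉ T → f i ≤ θ)
    (hc : θ * T.card = θ * k) (hS : S.card ≤ k) : ∑ i ∈ S, f i ≤ ∑ i ∈ T, f i := by
  classical
  have := sum_mul_le_of_top (w := fun i => if i ∈ S then 1 else 0) (β := 1)
    (Finset.subset_univ T) hθ hT hU hc (fun i _ => by split_ifs <;> simp)
    (fun i _ => by split_ifs <;> simp) (by simpa using hS)
  simpa using this

lemma exists_card_le_sum_max {ι : Type*} [Fintype ι] (f : ι → ℝ) (hf : ∀ i, 0 ≤ f i) (k : ℕ) :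
    ∃ T : Finset ι, T.card ≤ k ∧ ∀ S : Finset ι, S.card ≤ k → ∑ i ∈ S, f i ≤ ∑ i ∈ T, f i := by
  obtain ⟨T, -, hTk, θ, hθ, h1, h2, h3⟩ := exists_top Finset.univ f hf k
  exact ⟨T, hTk, fun S hS => sum_le_sum_of_top hθ h1 h2 h3 hS⟩

/-! ### Conditions implying the null space property -/

variable {m n : ℕ} {A : Matrix (Fin m) (Fin n) ℝ} {k : ℕ}

lemma sum_abs_pos {ζ : Fin n → ℝ} (hζ : ζ ≠ 0) (S : Finset (Fin n)) :
    0 < ∑ i ∈ S, |ζ i| + ∑ i ∈ Sᶜ, |ζ i| := by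
  rw [Finset.sum_add_sum_compl]
  obtain ⟨i, hi⟩ := Function.ne_iff.1 hζ
  exact Finset.sum_pos' (fun _ _ => abs_nonneg _) ⟨i, Finset.mem_univ _, abs_pos.2 hi⟩

lemma StableNSP.nsp {ρ : ℝ} (h : StableNSP A k ρ) (hρ : ρ < 1) : NSP A k := by
  intro ζ hζ hA S hS
  have h1 := h ζ hζ hA S hS
  have h2 := sum_abs_pos hζ S
  have h3 : 0 ≤ ∑ i ∈ Sᶜ, |ζ i| := Finset.sum_nonneg fun _ _ => abs_nonneg _
  rcases eq_or_lt_of_le h3 with h4 | h4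
  · rw [← h4] at h1 h2
    linarith
  · nlinarith

lemma RobustNSP.stableNSP {ρ' ρ'' : ℝ} (h : RobustNSP A k ρ' ρ'') : StableNSP A k ρ' := by
  intro ζ hζ hA S hS
  have h1 := h ζ hζ hA S hS
  rw [hA] at h1
  simpa [lpN] using h1

lemma le_coherence {s : ℕ} {i : Fin n} {S : Finset (Fin n)} (hS : S.card ≤ s) (hi : i ∉ S) :
    ∑ j ∈ S, |∑ l, A l i * A l j| ≤ coherence A s := by
  refine le_csSup (Set.Finite.bddAbove ?_) ⟨i, S, hS, hi, rfl⟩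
  refine (Set.finite_range fun p : Fin n × Finset (Fin n) =>
    ∑ j ∈ p.2, |∑ l, A l p.1 * A l j|).subset ?_
  rintro _ ⟨i, S, -, -, rfl⟩
  exact ⟨(i, S), rfl⟩

/-- Row i of AᵀAζ = 0 expresses ζ_i through the other entries. Summed over i ∈ S, an index j ∈ S
meets at most k − 1 others, which costs μ₁(k − 1), and an index j ∉ S meets at most k, which costs
μ₁(k). -/
lemma nsp_of_coherence (hN : NormalizedCols A) (h : coherence A k + coherence A (k - 1) < 1) :
    NSP A k := by
  intro ζ hζ hA S hS
  set g : Fin n → Fin n → ℝ := fun i j => |∑ l, A l i * A l j| with hg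
  have hgs : ∀ i j, g i j = g j i := fun i j => by simp only [hg, mul_comm]
  have hdiag : ∀ i, ∑ l, A l i * A l i = 1 := by
    intro i
    have := lpN_two_sq fun l => A l i
    rw [hN i] at this
    simp only [← sq, ← this]; norm_num
  have hz : ∀ i, |ζ i| ≤ ∑ j ∈ Finset.univ.erase i, g i j * |ζ j| := by
    intro i
    have h0 : ∑ j, (∑ l, A l i * A l j) * ζ j = 0 := by
      have : ∑ l, A l i * (A *ᵥ ζ) l = 0 := by simp [hA]
      rw [← this]
      simp only [Matrix.mulVec, dotProduct, Finset.mul_sum, Finset.sum_mul]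
      rw [Finset.sum_comm]
      simp only [mul_assoc]
    rw [← Finset.add_sum_erase _ _ (Finset.mem_univ i), hdiag, one_mul] at h0
    rw [eq_neg_of_add_eq_zero_left h0, abs_neg]
    refine (Finset.abs_sum_le_sum_abs _ _).trans (le_of_eq ?_)
    exact Finset.sum_congr rfl fun j _ => abs_mul _ _
  have hsum : ∑ i ∈ S, |ζ i| ≤ ∑ j, (∑ i ∈ S.erase j, g j i) * |ζ j| := by
    refine (Finset.sum_le_sum fun i _ => hz i).trans (le_of_eq ?_)
    have e1 : ∀ i, ∑ j ∈ Finset.univ.erase i, g i j * |ζ j| =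
        ∑ j, if j ≠ i then g i j * |ζ j| else 0 := by
      intro i
      rw [← Finset.sum_filter]
      congr 1
      ext j; simp
    simp only [e1]
    rw [Finset.sum_comm]
    refine Finset.sum_congr rfl fun j _ => ?_
    rw [Finset.sum_mul, ← Finset.sum_filter]
    refine Finset.sum_congr ?_ fun i _ => by rw [hgs]
    ext i
    simp only [Finset.mem_filter, Finset.mem_erase, ne_eq, eq_comm, and_comm]
  rw [← Finset.sum_add_sum_compl S] at hsum
  have h1 : ∑ j ∈ S, (∑ i ∈ S.erase j, g j i) * |ζ j| ≤
      coherence A (k - 1) * ∑ j ∈ S, |ζ j| := by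
    rw [Finset.mul_sum]
    refine Finset.sum_le_sum fun j hj => mul_le_mul_of_nonneg_right ?_ (abs_nonneg _)
    refine le_coherence ?_ (Finset.notMem_erase j S)
    rw [Finset.card_erase_of_mem hj]
    omega
  have h2 : ∑ j ∈ Sᶜ, (∑ i ∈ S.erase j, g j i) * |ζ j| ≤ coherence A k * ∑ j ∈ Sᶜ, |ζ j| := by
    rw [Finset.mul_sum]
    refine Finset.sum_le_sum fun j hj => mul_le_mul_of_nonneg_right ?_ (abs_nonneg _)
    exact le_coherence ((Finset.card_le_card (Finset.erase_subset _ _)).trans hS)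
      (Finset.notMem_erase j S)
  have h3 : 0 ≤ ∑ i ∈ Sᶜ, |ζ i| := Finset.sum_nonneg fun _ _ => abs_nonneg _
  have h4 := sum_abs_pos hζ S
  have h5 : 0 ≤ coherence A k := by
    obtain ⟨i, -⟩ := Function.ne_iff.1 hζ
    simpa using le_coherence (A := A) (s := k) (i := i) (S := ∅) (by simp) (by simp)
  by_contra! h6
  nlinarith

lemma lpN_two_sq_eq_dotProduct {ι : Type*} [Fintype ι] (v : ι → ℝ) : lpN 2 v ^ 2 = v ⬝ᵥ v := by
  rw [lpN_two_sq, dotProduct]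
  exact Finset.sum_congr rfl fun i _ => sq _

/-- The null space property under the sharp bound of Cai and Zhang. -/
lemma RIP.nsp {δ : ℝ} (h : RIP A (2 * k) δ) (hδ : δ < 1 / √2) : NSP A k := by
  obtain ⟨hδ0, -, hrip⟩ := h
  intro ζ hζ hA S hS
  rcases Nat.eq_zero_or_pos k with rfl | hk
  · have h1 : S = ∅ := by simpa using hS
    have := sum_abs_pos hζ S
    rw [h1] at this ⊢
    simpa using this
  have hk' : (0 : ℝ) < k := by exact_mod_cast hk
  by_contra! hcon
  obtain ⟨T, -, hTk, θ, hθ, hT1, hT2, hT3⟩ :=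
    exists_top Finset.univ (fun i => |ζ i|) (fun i => abs_nonneg _) k
  have hST : ∑ i ∈ S, |ζ i| ≤ ∑ i ∈ T, |ζ i| :=
    sum_le_sum_of_top hθ hT1 hT2 hT3 hS
  have hTc : ∑ i ∈ Tᶜ, |ζ i| ≤ ∑ i ∈ T, |ζ i| := by
    have h1 := Finset.sum_add_sum_compl T fun i => |ζ i|
    have h2 := Finset.sum_add_sum_compl S fun i => |ζ i|
    linarith
  set β := (∑ i ∈ T, |ζ i|) / k with hβ
  have hβk : k * β = ∑ i ∈ T, |ζ i| := by rw [hβ]; field_simp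
  have hβ0 : 0 ≤ β := div_nonneg (Finset.sum_nonneg fun _ _ => abs_nonneg _) hk'.le
  have hθβ : θ ≤ β := by
    rw [hβ, le_div_iff₀ hk', ← hT3, mul_comm, ← nsmul_eq_mul]
    exact Finset.card_nsmul_le_sum _ _ _ hT1
  set x : Fin n → ℝ := fun i => if i ∈ T then ζ i else 0 with hx
  set a := A *ᵥ x with ha
  set l := Aᵀ *ᵥ a with hl
  have hlu : ∀ u, a ⬝ᵥ (A *ᵥ u) = l ⬝ᵥ u := by
    intro u
    rw [hl, Matrix.mulVec_transpose, Matrix.dotProduct_mulVec]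
  -- Since `a` = −A(tail of ζ), ‖a‖² is linear in the tail, whose entries are at most β in modulus
  -- with ℓ₁-norm at most kβ. The extremal such vector for this functional, ±β on the k largest |l
  -- i| off `T`, replaces the tail: it is k-sparse and still gives ⟨a, a⟩ + ⟨a, Au⟩ ≤ 0.
  obtain ⟨T', hT'T, hT'k, θ', hθ', hT'1, hT'2, hT'3⟩ :=
    exists_top Tᶜ (fun i => |l i|) (fun i => abs_nonneg _) k
  have hmax := sum_mul_le_of_top (w := fun i => |ζ i|) (β := β) hT'T hθ' hT'1 hT'2 hT'3
    (fun i _ => abs_nonneg _)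
    (fun i hi => (hT2 i (Finset.mem_univ _) (Finset.mem_compl.1 hi)).trans hθβ)
    (by rw [hβk]; exact hTc)
  set u : Fin n → ℝ := fun i => if i ∈ T' then (if 0 ≤ l i then -β else β) else 0 with hu
  have hlu' : l ⬝ᵥ u = -(β * ∑ i ∈ T', |l i|) := by
    rw [dotProduct, Finset.mul_sum, ← Finset.sum_neg_distrib,
      ← Finset.sum_subset (Finset.subset_univ T')]
    · refine Finset.sum_congr rfl fun i hi => ?_
      simp only [hu, if_pos hi]
      split_ifs with h0
      · rw [abs_of_nonneg h0]; ring
      · rw [abs_of_neg (not_le.1 h0)]; ring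
    · intro i _ hi
      simp [hu, hi]
  have hPQ : a ⬝ᵥ a + a ⬝ᵥ (A *ᵥ u) ≤ 0 := by
    have e1 : a + A *ᵥ (fun i => if i ∈ T then 0 else ζ i) = 0 := by
      rw [ha, ← Matrix.mulVec_add, ← hA]
      congr 1
      ext i
      simp only [hx, Pi.add_apply]
      split_ifs <;> simp
    have e2 : a ⬝ᵥ a = -∑ i ∈ Tᶜ, l i * ζ i := by
      have : a ⬝ᵥ a + a ⬝ᵥ (A *ᵥ (fun i => if i ∈ T then 0 else ζ i)) = 0 := by
        rw [← dotProduct_add, e1, dotProduct_zero]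
      rw [hlu fun i => if i ∈ T then 0 else ζ i] at this
      rw [eq_neg_of_add_eq_zero_left this, dotProduct]
      congr 1
      rw [← Finset.sum_subset (Finset.subset_univ Tᶜ)]
      · refine Finset.sum_congr rfl fun i hi => ?_
        rw [if_neg (Finset.mem_compl.1 hi)]
      · intro i _ hi
        rw [if_pos (by simpa using hi), mul_zero]
    have e3 : -∑ i ∈ Tᶜ, l i * ζ i ≤ ∑ i ∈ Tᶜ, |l i| * |ζ i| := by
      rw [← Finset.sum_neg_distrib]
      exact Finset.sum_le_sum fun i _ => by rw [← abs_mul]; exact neg_le_abs _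
    rw [hlu u, hlu', e2]
    linarith
  have hxu : x ⬝ᵥ u = 0 := by
    rw [dotProduct]
    refine Finset.sum_eq_zero fun i _ => ?_
    by_cases h1 : i ∈ T
    · have : i ∉ T' := fun h2 => Finset.mem_compl.1 (hT'T h2) h1
      simp [hu, this]
    · simp [hx, h1]
  have hgen : ∀ p r : ℝ,
      (1 - δ) * (p ^ 2 * (x ⬝ᵥ x) + r ^ 2 * (u ⬝ᵥ u)) ≤ p ^ 2 * (a ⬝ᵥ a) +
        2 * p * r * (a ⬝ᵥ (A *ᵥ u)) + r ^ 2 * ((A *ᵥ u) ⬝ᵥ (A *ᵥ u)) ∧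
      p ^ 2 * (a ⬝ᵥ a) + 2 * p * r * (a ⬝ᵥ (A *ᵥ u)) + r ^ 2 * ((A *ᵥ u) ⬝ᵥ (A *ᵥ u)) ≤
        (1 + δ) * (p ^ 2 * (x ⬝ᵥ x) + r ^ 2 * (u ⬝ᵥ u)) := by
    intro p r
    have hl0 : l0 (p • x + r • u) ≤ 2 * k := by
      have hsub : {i | (p • x + r • u) i ≠ 0} ⊆ ((T ∪ T' : Finset (Fin n)) : Set (Fin n)) := by
        intro i hi
        by_contra hni
        simp only [Finset.coe_union, Set.mem_union, Finset.mem_coe, not_or] at hni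
        apply hi
        simp [hx, hu, hni.1, hni.2]
      refine (Set.ncard_le_ncard hsub (Finset.finite_toSet _)).trans ?_
      rw [Set.ncard_coe_finset]
      have := Finset.card_union_le T T'
      omega
    have h1 := hrip _ hl0
    have e1 : lpN 2 (p • x + r • u) ^ 2 = p ^ 2 * (x ⬝ᵥ x) + r ^ 2 * (u ⬝ᵥ u) := by
      rw [lpN_two_sq_eq_dotProduct]
      simp only [add_dotProduct, dotProduct_add, smul_dotProduct, dotProduct_smul, smul_eq_mul,
        dotProduct_comm u x, hxu]
      ring
    have e2 : lpN 2 (A *ᵥ (p • x + r • u)) ^ 2 = p ^ 2 * (a ⬝ᵥ a) +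
        2 * p * r * (a ⬝ᵥ (A *ᵥ u)) + r ^ 2 * ((A *ᵥ u) ⬝ᵥ (A *ᵥ u)) := by
      rw [lpN_two_sq_eq_dotProduct, Matrix.mulVec_add, Matrix.mulVec_smul, Matrix.mulVec_smul, ← ha]
      simp only [add_dotProduct, dotProduct_add, smul_dotProduct, dotProduct_smul, smul_eq_mul,
        dotProduct_comm (A *ᵥ u) a]
      ring
    rwa [e1, e2] at h1
  have hxx : x ⬝ᵥ x = ∑ i ∈ T, |ζ i| ^ 2 := by
    rw [dotProduct, ← Finset.sum_subset (Finset.subset_univ T)]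
    · refine Finset.sum_congr rfl fun i hi => ?_
      simp [hx, hi, sq]
    · intro i _ hi
      simp [hx, hi]
  have hkx : k * β ^ 2 ≤ x ⬝ᵥ x := by
    have h1 := sq_sum_le_card_mul_sum_sq (s := T) (f := fun i => |ζ i|)
    rw [← hβk, ← hxx] at h1
    have h2 : (T.card : ℝ) * (x ⬝ᵥ x) ≤ k * (x ⬝ᵥ x) := by
      refine mul_le_mul_of_nonneg_right (by exact_mod_cast hTk) ?_
      rw [hxx]; exact Finset.sum_nonneg fun _ _ => sq_nonneg _
    have h3 : k * (k * β ^ 2) ≤ k * (x ⬝ᵥ x) := by linarith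
    exact le_of_mul_le_mul_left h3 hk'
  have huu : u ⬝ᵥ u ≤ x ⬝ᵥ x := by
    refine le_trans ?_ hkx
    have h1 : u ⬝ᵥ u = T'.card * β ^ 2 := by
      rw [dotProduct, ← Finset.sum_subset (Finset.subset_univ T'), ← nsmul_eq_mul,
        ← Finset.sum_const]
      · refine Finset.sum_congr rfl fun i hi => ?_
        simp only [hu, if_pos hi]
        split_ifs <;> ring
      · intro i _ hi
        simp [hu, hi]
    rw [h1]
    exact mul_le_mul_of_nonneg_right (by exact_mod_cast hT'k) (sq_nonneg _)
  have hxpos : 0 < x ⬝ᵥ x := by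
    by_contra! h0
    have hβ2 : β = 0 := by
      have : β ^ 2 ≤ 0 := by
        by_contra! h1
        have := mul_pos hk' h1
        linarith
      exact pow_eq_zero_iff two_ne_zero |>.1 (le_antisymm this (sq_nonneg _))
    have := sum_abs_pos hζ T
    rw [hβ2, mul_zero] at hβk
    linarith
  -- The root of c² + 2c = 1 maximizes (c − c²)/(1/2 − c + 3c²/2), the bound on δ that the argument
  -- yields; the maximum is 1/√2.
  set c : ℝ := √2 - 1 with hc
  have hs : √2 ^ 2 = 2 := Real.sq_sqrt (by norm_num)
  have hs1 : 1.41 < √2 := Real.lt_sqrt_of_sq_lt (by norm_num)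
  have hs2 : √2 < 1.42 := by rw [Real.sqrt_lt' (by norm_num)]; norm_num
  have hδ2 : δ * √2 < 1 := by rwa [lt_div_iff₀ (by positivity)] at hδ
  have i1 := (hgen (1 / 2 - c) (-(c / 2))).2
  have i2 := (hgen 1 c).1
  generalize x ⬝ᵥ x = X at *
  generalize u ⬝ᵥ u = U at *
  generalize a ⬝ᵥ a = P at *
  generalize a ⬝ᵥ (A *ᵥ u) = Q at *
  generalize (A *ᵥ u) ⬝ᵥ (A *ᵥ u) = R at *
  have hc2 : c ^ 2 = 1 - 2 * c := by rw [hc]; linear_combination hs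
  have hc0 : 0 < c := by rw [hc]; linarith
  -- `i1` minus a quarter of `i2`: the terms in ‖Au‖² cancel, and P and Q get the same coefficient
  -- c² − c < 0.
  have j1 : (c ^ 2 - c) * (P + Q) ≤
      (1 + δ) * ((1 / 2 - c) ^ 2 * X + c ^ 2 / 4 * U) - (1 - δ) / 4 * (X + c ^ 2 * U) := by
    linarith
  have j2 : 0 ≤ (c ^ 2 - c) * (P + Q) := by
    apply mul_nonneg_of_nonpos_of_nonpos _ hPQ
    rw [hc2, hc]; linarith
  have j3 : (1 + δ) * ((1 / 2 - c) ^ 2 * X + c ^ 2 / 4 * U) - (1 - δ) / 4 * (X + c ^ 2 * U) ≤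
      (1 - 3 * c + δ * (2 - 4 * c)) * X := by
    have : 0 ≤ c ^ 2 * δ / 2 * (X - U) := mul_nonneg (by positivity) (by linarith)
    have e : (1 - 3 * c + δ * (2 - 4 * c)) * X =
      (1 + δ) * ((1 / 2 - c) ^ 2 * X + c ^ 2 / 4 * U) - (1 - δ) / 4 * (X + c ^ 2 * U)
        + c ^ 2 * δ / 2 * (X - U) := by
      linear_combination (-(1 + 3 * δ / 2) * X) * hc2
    linarith
  have j4 : (1 - 3 * c + δ * (2 - 4 * c)) < 0 := by
    have e : √2 * (1 - 3 * c + δ * (2 - 4 * c)) = (6 - 4 * √2) * (δ * √2 - 1) := by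
      rw [hc]; linear_combination (-3) * hs
    have : √2 * (1 - 3 * c + δ * (2 - 4 * c)) < 0 := by
      rw [e]; exact mul_neg_of_pos_of_neg (by linarith) (by linarith)
    by_contra! h7
    have := mul_nonneg (Real.sqrt_nonneg 2) h7
    linarith
  have := mul_neg_of_neg_of_pos j4 hxpos
  linarith

/-! ### Invertible submatrices and the constant `c` -/

lemma isUnit_of_rank_eq {m : ℕ} {B : Matrix (Fin m) (Fin m) ℝ} (h : B.rank = m) : IsUnit B := by
  rw [← Matrix.linearIndependent_cols_iff_isUnit, linearIndependent_iff_card_eq_finrank_span,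
    Set.finrank, ← Matrix.rank_eq_finrank_span_cols, h, Fintype.card_fin]

lemma exists_isUnit_submatrix {m q : ℕ} {M : Matrix (Fin m) (Fin q) ℝ} (hM : M.rank = m) :
    ∃ (G : Finset (Fin q)) (hG : G.card = m), IsUnit (M.submatrix id (G.orderEmbOfFin hG)) := by
  classical
  obtain ⟨κ, a, ha, hspan, hli⟩ := exists_linearIndependent' ℝ M.col
  have : Finite κ := Finite.of_injective a ha
  have := Fintype.ofFinite κ
  have hfin : Module.finrank ℝ (Submodule.span ℝ (Set.range (M.col ∘ a))) = m := by
    rw [hspan, ← Matrix.rank_eq_finrank_span_cols, hM]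
  have hG : (Finset.univ.image a).card = m := by
    rw [Finset.card_image_of_injective _ ha, Finset.card_univ, ← hfin]
    exact linearIndependent_iff_card_eq_finrank_span.1 hli
  refine ⟨Finset.univ.image a, hG, isUnit_of_rank_eq ?_⟩
  rw [Matrix.rank_eq_finrank_span_cols]
  refine Eq.trans ?_ hfin
  have : (M.submatrix id ((Finset.univ.image a).orderEmbOfFin hG)).col =
      M.col ∘ (Finset.univ.image a).orderEmbOfFin hG := rfl
  rw [this, Set.range_comp, Finset.range_orderEmbOfFin, Set.range_comp, Finset.coe_image,
    Finset.coe_univ, Set.image_univ]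

lemma lpN_one_mulVec_le {ι κ : Type*} [Fintype ι] [Fintype κ] (Q : Matrix ι κ ℝ) {x : κ → ℝ}
    (hx : lpN ⊤ x ≤ 1) : lpN 1 (Q *ᵥ x) ≤ ∑ i, ∑ j, |Q i j| := by
  rw [lpN_one]
  refine Finset.sum_le_sum fun i _ => (Finset.abs_sum_le_sum_abs _ _).trans ?_
  refine Finset.sum_le_sum fun j _ => ?_
  rw [abs_mul]
  exact mul_le_of_le_one_right (abs_nonneg _) ((abs_le_lpN_top x j).trans hx)

lemma le_inducedN {ι κ : Type*} [Fintype ι] [Fintype κ] (Q : Matrix ι κ ℝ) {x : κ → ℝ}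
    (hx : lpN ⊤ x ≤ 1) : lpN 1 (Q *ᵥ x) ≤ inducedN ⊤ 1 Q := by
  refine le_csSup ⟨∑ i, ∑ j, |Q i j|, ?_⟩ ⟨x, hx, rfl⟩
  rintro _ ⟨z, hz, rfl⟩
  exact lpN_one_mulVec_le Q hz

lemma cConst_nonneg {m n q : ℕ} (A : Matrix (Fin m) (Fin n) ℝ) (M : Matrix (Fin m) (Fin q) ℝ) :
    0 ≤ cConst A M := by
  apply Real.sSup_nonneg
  rintro _ ⟨G, hG, -, rfl⟩
  apply Real.sSup_nonneg
  rintro _ ⟨x, -, rfl⟩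
  exact lpN_one_nonneg _

lemma inducedN_le_cConst {m n q : ℕ} (A : Matrix (Fin m) (Fin n) ℝ)
    (M : Matrix (Fin m) (Fin q) ℝ) (G : Finset (Fin q)) (hG : G.card = m)
    (hu : IsUnit (M.submatrix id (G.orderEmbOfFin hG))) :
    inducedN ⊤ 1 ((M.submatrix id (G.orderEmbOfFin hG))⁻¹ * (A * Aᵀ)⁻¹ * A) ≤ cConst A M := by
  refine le_csSup (Set.Finite.bddAbove ?_) ⟨G, hG, hu, rfl⟩
  refine (Set.finite_range fun G : {G : Finset (Fin q) // G.card = m} => inducedN ⊤ 1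
    ((M.submatrix id (G.1.orderEmbOfFin G.2))⁻¹ * (A * Aᵀ)⁻¹ * A)).subset ?_
  rintro _ ⟨G, hG, -, rfl⟩
  exact ⟨⟨G, hG⟩, rfl⟩

/-- Take the basic solution supported on an invertible column set G: h_G = M_G⁻¹u, where u =
(AAᵀ)⁻¹A(Aᵀu) is recovered from a vector of sup-norm at most 1. This is where `cConst` comes from.
-/
lemma exists_mulVec_eq_of_range {m n q : ℕ} {A : Matrix (Fin m) (Fin n) ℝ}
    {M : Matrix (Fin m) (Fin q) ℝ} (hA : A.rank = m) (hM : M.rank = m) {u : Fin m → ℝ}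
    (hu : ∀ i, |(Aᵀ *ᵥ u) i| ≤ 1) : ∃ h : Fin q → ℝ, M *ᵥ h = u ∧ ∑ j, |h j| ≤ cConst A M := by
  obtain ⟨G, hG, hunit⟩ := exists_isUnit_submatrix hM
  have hAA : IsUnit (A * Aᵀ).det :=
    (Matrix.isUnit_iff_isUnit_det _).1
      (isUnit_of_rank_eq (by rw [Matrix.rank_self_mul_transpose, hA]))
  set e := G.orderEmbOfFin hG with he
  set B := M.submatrix id e with hB
  have hBdet := (Matrix.isUnit_iff_isUnit_det _).1 hunit
  set w := (B⁻¹ * (A * Aᵀ)⁻¹ * A) *ᵥ (Aᵀ *ᵥ u) with hw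
  have hBw : B *ᵥ w = u := by
    have e1 : B * (B⁻¹ * (A * Aᵀ)⁻¹ * A) * Aᵀ = (B * B⁻¹) * ((A * Aᵀ)⁻¹ * (A * Aᵀ)) := by
      simp only [Matrix.mul_assoc]
    rw [hw, Matrix.mulVec_mulVec, Matrix.mulVec_mulVec, e1, Matrix.nonsing_inv_mul _ hAA,
      Matrix.mul_one, Matrix.mul_nonsing_inv _ hBdet, Matrix.one_mulVec]
  have hw1 : ∑ i, |w i| ≤ cConst A M := by
    rw [← lpN_one]
    exact (le_inducedN _ (lpN_top_le zero_le_one hu)).trans (inducedN_le_cConst A M G hG hunit)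
  refine ⟨Function.extend e w 0, ?_, ?_⟩
  · rw [← hBw]
    ext i
    refine (Fintype.sum_of_injective e e.injective _ _ (fun j hj => ?_) fun j => ?_).symm
    · rw [Function.extend_apply' _ _ _ hj]; simp
    · rw [e.injective.extend_apply]; rfl
  · refine le_trans (le_of_eq ?_) hw1
    refine (Fintype.sum_of_injective e e.injective _ _ (fun j hj => ?_) fun j => ?_).symm
    · rw [Function.extend_apply' _ _ _ hj]; simp
    · rw [e.injective.extend_apply]

lemma exists_mulVec_eq {m n : ℕ} {A : Matrix (Fin m) (Fin n) ℝ} (hA : A.rank = m)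
    (y : Fin m → ℝ) : ∃ x, A *ᵥ x = y := by
  have hAA : IsUnit (A * Aᵀ).det :=
    (Matrix.isUnit_iff_isUnit_det _).1
      (isUnit_of_rank_eq (by rw [Matrix.rank_self_mul_transpose, hA]))
  refine ⟨Aᵀ *ᵥ ((A * Aᵀ)⁻¹ *ᵥ y), ?_⟩
  rw [Matrix.mulVec_mulVec, Matrix.mulVec_mulVec, Matrix.mul_nonsing_inv _ hAA, Matrix.one_mulVec]

/-! ### The optimality system -/

section System

variable {m n q : ℕ}

/-- The vector `(x, t, ξ, v, w⁽¹⁾, …, w⁽⁷⁾)`. -/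
def colVec (x t : Fin n → ℝ) (ξ : ℝ) (v : Fin q → ℝ) (w₁ w₂ : Fin n → ℝ) (w₃ : ℝ)
    (w₄ w₅ w₆ w₇ : Fin q → ℝ) : Cols n q → ℝ :=
  Sum.elim x <| Sum.elim t <| Sum.elim (fun _ => ξ) <| Sum.elim v <| Sum.elim w₁ <| Sum.elim w₂ <|
    Sum.elim (fun _ => w₃) <| Sum.elim w₄ <| Sum.elim w₅ <| Sum.elim w₆ w₇

/-- A vector indexed by the rows of `M¹`, block by block. -/
def rowVec (b₁ b₂ : Fin n → ℝ) (b₃ : ℝ) (b₄ b₅ b₆ b₇ : Fin q → ℝ) (b₈ : Fin n → ℝ) (b₉ : ℝ)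
    (b₁₀ : Fin q → ℝ) (b₁₁ b₁₂ : Fin n → ℝ) (b₁₃ : ℝ) (b₁₄ b₁₅ b₁₆ b₁₇ : Fin q → ℝ) :
    Rows₁ n q → ℝ :=
  Sum.elim b₁ <| Sum.elim b₂ <| Sum.elim (fun _ => b₃) <| Sum.elim b₄ <| Sum.elim b₅ <| Sum.elim b₆ <| Sum.elim b₇ <|
    Sum.elim b₈ <| Sum.elim (fun _ => b₉) <| Sum.elim b₁₀ <| Sum.elim b₁₁ <| Sum.elim b₁₂ <|
    Sum.elim (fun _ => b₁₃) <| Sum.elim b₁₄ <| Sum.elim b₁₅ <| Sum.elim b₁₆ b₁₇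

lemma exists_eq_sumElim {ι κ : Type*} (z : ι ⊕ κ → ℝ) : ∃ a b, z = Sum.elim a b :=
  ⟨_, _, (Sum.elim_comp_inl_inr z).symm⟩

lemma exists_eq_const (z : Unit → ℝ) : ∃ c, z = fun _ => c := ⟨z (), rfl⟩

lemma exists_eq_colVec (z : Cols n q → ℝ) : ∃ x t ξ v w₁ w₂ w₃ w₄ w₅ w₆ w₇,
    z = colVec x t ξ v w₁ w₂ w₃ w₄ w₅ w₆ w₇ := by
  obtain ⟨x, z, rfl⟩ := exists_eq_sumElim z
  obtain ⟨t, z, rfl⟩ := exists_eq_sumElim z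
  obtain ⟨ξ', z, rfl⟩ := exists_eq_sumElim z
  obtain ⟨ξ, rfl⟩ := exists_eq_const ξ'
  obtain ⟨v, z, rfl⟩ := exists_eq_sumElim z
  obtain ⟨w₁, z, rfl⟩ := exists_eq_sumElim z
  obtain ⟨w₂, z, rfl⟩ := exists_eq_sumElim z
  obtain ⟨w₃', z, rfl⟩ := exists_eq_sumElim z
  obtain ⟨w₃, rfl⟩ := exists_eq_const w₃'
  obtain ⟨w₄, z, rfl⟩ := exists_eq_sumElim z
  obtain ⟨w₅, z, rfl⟩ := exists_eq_sumElim z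
  obtain ⟨w₆, w₇, rfl⟩ := exists_eq_sumElim z
  exact ⟨x, t, ξ, v, w₁, w₂, w₃, w₄, w₅, w₆, w₇, rfl⟩

lemma exists_eq_rowVec (z : Rows₁ n q → ℝ) :
    ∃ b₁ b₂ b₃ b₄ b₅ b₆ b₇ b₈ b₉ b₁₀ b₁₁ b₁₂ b₁₃ b₁₄ b₁₅ b₁₆ b₁₇,
    z = rowVec b₁ b₂ b₃ b₄ b₅ b₆ b₇ b₈ b₉ b₁₀ b₁₁ b₁₂ b₁₃ b₁₄ b₁₅ b₁₆ b₁₇ := by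
  obtain ⟨b₁, z, rfl⟩ := exists_eq_sumElim z
  obtain ⟨b₂, z, rfl⟩ := exists_eq_sumElim z
  obtain ⟨b₃', z, rfl⟩ := exists_eq_sumElim z
  obtain ⟨b₃, rfl⟩ := exists_eq_const b₃'
  obtain ⟨b₄, z, rfl⟩ := exists_eq_sumElim z
  obtain ⟨b₅, z, rfl⟩ := exists_eq_sumElim z
  obtain ⟨b₆, z, rfl⟩ := exists_eq_sumElim z
  obtain ⟨b₇, z, rfl⟩ := exists_eq_sumElim z
  obtain ⟨b₈, z, rfl⟩ := exists_eq_sumElim z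
  obtain ⟨b₉', z, rfl⟩ := exists_eq_sumElim z
  obtain ⟨b₉, rfl⟩ := exists_eq_const b₉'
  obtain ⟨b₁₀, z, rfl⟩ := exists_eq_sumElim z
  obtain ⟨b₁₁, z, rfl⟩ := exists_eq_sumElim z
  obtain ⟨b₁₂, z, rfl⟩ := exists_eq_sumElim z
  obtain ⟨b₁₃', z, rfl⟩ := exists_eq_sumElim z
  obtain ⟨b₁₃, rfl⟩ := exists_eq_const b₁₃'
  obtain ⟨b₁₄, z, rfl⟩ := exists_eq_sumElim z
  obtain ⟨b₁₅, z, rfl⟩ := exists_eq_sumElim z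
  obtain ⟨b₁₆, b₁₇, rfl⟩ := exists_eq_sumElim z
  exact ⟨b₁, b₂, b₃, b₄, b₅, b₆, b₇, b₈, b₉, b₁₀, b₁₁, b₁₂, b₁₃, b₁₄, b₁₅, b₁₆, b₁₇, rfl⟩

/-- The right-hand side of the inequalities of the optimality system. -/
def rhs₁ (M : Matrix (Fin m) (Fin q) ℝ) (y : Fin m → ℝ) (τ : ℝ) : Rows₁ n q → ℝ :=
  rowVec 0 0 τ (Mᵀ *ᵥ y) (-(Mᵀ *ᵥ y)) (Mᵀ *ᵥ y) (-(Mᵀ *ᵥ y)) 1 0 0 0 0 0 0 0 0 0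

lemma onesCol_mulVec (R : Type) (c : Unit → ℝ) : onesCol R *ᵥ c = fun _ => c () := by
  ext i; simp [onesCol, Matrix.mulVec, dotProduct]

lemma onesCol_transpose_mulVec (R : Type) [Fintype R] (v : R → ℝ) :
    (onesCol R)ᵀ *ᵥ v = fun _ => ∑ i, v i := by
  ext i; simp [onesCol, Matrix.mulVec, dotProduct]

lemma yTM_mulVec (M : Matrix (Fin m) (Fin q) ℝ) (y : Fin m → ℝ) (v : Fin q → ℝ) :
    yTM M y *ᵥ v = fun _ => y ⬝ᵥ (M *ᵥ v) := by
  ext i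
  rw [Matrix.dotProduct_mulVec]; rfl

lemma blockRow_mulVec {R : Type} (B₁ B₂ : Matrix R (Fin n) ℝ) (B₃ : Matrix R Unit ℝ)
    (B₄ : Matrix R (Fin q) ℝ) (B₅ B₆ : Matrix R (Fin n) ℝ) (B₇ : Matrix R Unit ℝ)
    (B₈ B₉ B₁₀ B₁₁ : Matrix R (Fin q) ℝ) (x t : Fin n → ℝ) (ξ : ℝ) (v : Fin q → ℝ)
    (w₁ w₂ : Fin n → ℝ) (w₃ : ℝ) (w₄ w₅ w₆ w₇ : Fin q → ℝ) :
    blockRow B₁ B₂ B₃ B₄ B₅ B₆ B₇ B₈ B₉ B₁₀ B₁₁ *ᵥ colVec x t ξ v w₁ w₂ w₃ w₄ w₅ w₆ w₇ =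
      B₁ *ᵥ x + (B₂ *ᵥ t + (B₃ *ᵥ (fun _ => ξ) + (B₄ *ᵥ v + (B₅ *ᵥ w₁ + (B₆ *ᵥ w₂ +
        (B₇ *ᵥ (fun _ => w₃) + (B₈ *ᵥ w₄ + (B₉ *ᵥ w₅ + (B₁₀ *ᵥ w₆ + B₁₁ *ᵥ w₇))))))))) := by
  simp only [blockRow, Matrix.fromCols_mulVec, colVec, Sum.elim_comp_inl, Sum.elim_comp_inr]

lemma matM₁_mulVec (A : Matrix (Fin m) (Fin n) ℝ) (M : Matrix (Fin m) (Fin q) ℝ) (α : ℝ)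
    (x t : Fin n → ℝ) (ξ : ℝ) (v : Fin q → ℝ) (w₁ w₂ : Fin n → ℝ) (w₃ : ℝ)
    (w₄ w₅ w₆ w₇ : Fin q → ℝ) :
    matM₁ A M α *ᵥ colVec x t ξ v w₁ w₂ w₃ w₄ w₅ w₆ w₇ =
      rowVec (x - t) (-x - t) (α * ξ + (1 - α) * ∑ j, v j)
        (Mᵀ *ᵥ (A *ᵥ x) - fun _ => ξ) (-(Mᵀ *ᵥ (A *ᵥ x)) - fun _ => ξ)
        (Mᵀ *ᵥ (A *ᵥ x) - v) (-(Mᵀ *ᵥ (A *ᵥ x)) - v) (w₁ + w₂)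
        (-(α * w₃) + ∑ j, w₄ j + ∑ j, w₅ j) (w₆ + w₇ - fun _ => (1 - α) * w₃)
        (-w₁) (-w₂) (-w₃) (-w₄) (-w₅) (-w₆) (-w₇) := by
  simp only [matM₁, Matrix.fromRows_mulVec, blockRow_mulVec, rowVec, Matrix.zero_mulVec,
    Matrix.one_mulVec, Matrix.neg_mulVec, Matrix.smul_mulVec, onesCol_mulVec,
    onesCol_transpose_mulVec, zero_add, add_zero, Matrix.mulVec_mulVec]
  refine congrArg₂ _ ?_ (congrArg₂ _ ?_ (congrArg₂ _ ?_ (congrArg₂ _ ?_ (congrArg₂ _ ?_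
    (congrArg₂ _ ?_ (congrArg₂ _ ?_ (congrArg₂ _ rfl (congrArg₂ _ ?_ (congrArg₂ _ ?_ ?_)))))))))
  all_goals first | rfl | (ext; simp; ring)

lemma matM₂_mulVec (A : Matrix (Fin m) (Fin n) ℝ) (M : Matrix (Fin m) (Fin q) ℝ) (y : Fin m → ℝ)
    (τ : ℝ) (x t : Fin n → ℝ) (ξ : ℝ) (v : Fin q → ℝ) (w₁ w₂ : Fin n → ℝ) (w₃ : ℝ)
    (w₄ w₅ w₆ w₇ : Fin q → ℝ) :
    matM₂ A M y τ *ᵥ colVec x t ξ v w₁ w₂ w₃ w₄ w₅ w₆ w₇ =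
      Sum.elim (Aᵀ *ᵥ (M *ᵥ (w₄ - w₅ - w₆ + w₇)) - (w₁ - w₂))
        (fun _ => ∑ i, t i + τ * w₃ - y ⬝ᵥ (M *ᵥ (w₄ - w₅ - w₆ + w₇))) := by
  simp only [matM₂, Matrix.fromRows_mulVec, blockRow_mulVec, Matrix.zero_mulVec,
    Matrix.one_mulVec, Matrix.neg_mulVec, Matrix.smul_mulVec, yTM_mulVec,
    onesCol_transpose_mulVec, zero_add, ← Matrix.mulVec_mulVec, Matrix.mulVec_add,
    Matrix.mulVec_sub, dotProduct_add, dotProduct_sub]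
  congr 1
  · ext; simp; ring
  · ext; simp; ring

/-- The constraints on `w⁽¹⁾, …, w⁽⁷⁾` in the optimality system. -/
structure DualFeasible (A : Matrix (Fin m) (Fin n) ℝ) (M : Matrix (Fin m) (Fin q) ℝ) (α : ℝ)
    (w₁ w₂ : Fin n → ℝ) (w₃ : ℝ) (w₄ w₅ w₆ w₇ : Fin q → ℝ) : Prop where
  add_le : ∀ i, w₁ i + w₂ i ≤ 1
  sum_le : ∑ j, w₄ j + ∑ j, w₅ j ≤ α * w₃
  le : ∀ j, w₆ j + w₇ j ≤ (1 - α) * w₃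
  nonneg₁ : ∀ i, 0 ≤ w₁ i
  nonneg₂ : ∀ i, 0 ≤ w₂ i
  nonneg₃ : 0 ≤ w₃
  nonneg₄ : ∀ j, 0 ≤ w₄ j
  nonneg₅ : ∀ j, 0 ≤ w₅ j
  nonneg₆ : ∀ j, 0 ≤ w₆ j
  nonneg₇ : ∀ j, 0 ≤ w₇ j
  eq : Aᵀ *ᵥ (M *ᵥ (w₄ - w₅ - w₆ + w₇)) = w₁ - w₂

/-- The constraints on `(x, t, ξ, v)` in the optimality system. -/
structure PrimalFeasible (A : Matrix (Fin m) (Fin n) ℝ) (M : Matrix (Fin m) (Fin q) ℝ)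
    (y : Fin m → ℝ) (τ α : ℝ) (x t : Fin n → ℝ) (ξ : ℝ) (v : Fin q → ℝ) : Prop where
  abs_le_t : ∀ i, |x i| ≤ t i
  le : α * ξ + (1 - α) * ∑ j, v j ≤ τ
  abs_le_xi : ∀ j, |(Mᵀ *ᵥ (A *ᵥ x - y)) j| ≤ ξ
  abs_le_v : ∀ j, |(Mᵀ *ᵥ (A *ᵥ x - y)) j| ≤ v j

variable {A : Matrix (Fin m) (Fin n) ℝ} {M : Matrix (Fin m) (Fin q) ℝ} {y : Fin m → ℝ} {τ α : ℝ}
  {x t : Fin n → ℝ} {ξ : ℝ} {v : Fin q → ℝ} {w₁ w₂ : Fin n → ℝ} {w₃ : ℝ}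
  {w₄ w₅ w₆ w₇ : Fin q → ℝ}

lemma matM₁_mulVec_le_iff :
    matM₁ A M α *ᵥ colVec x t ξ v w₁ w₂ w₃ w₄ w₅ w₆ w₇ ≤ rhs₁ M y τ ↔
      PrimalFeasible A M y τ α x t ξ v ∧ (∀ i, w₁ i + w₂ i ≤ 1) ∧
      ∑ j, w₄ j + ∑ j, w₅ j ≤ α * w₃ ∧ (∀ j, w₆ j + w₇ j ≤ (1 - α) * w₃) ∧ (∀ i, 0 ≤ w₁ i) ∧
      (∀ i, 0 ≤ w₂ i) ∧ 0 ≤ w₃ ∧ (∀ j, 0 ≤ w₄ j) ∧ (∀ j, 0 ≤ w₅ j) ∧ (∀ j, 0 ≤ w₆ j) ∧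
      ∀ j, 0 ≤ w₇ j := by
  rw [matM₁_mulVec, rhs₁]
  simp only [rowVec, Sum.elim_le_elim_iff]
  simp only [Pi.le_def, Pi.sub_apply, Pi.neg_apply, Pi.add_apply,
    Pi.zero_apply, Pi.one_apply, forall_const, neg_nonpos]
  constructor
  · rintro ⟨h1, h2, h3, h4, h5, h6, h7, h8, h9, h10, h11, h12, h13, h14, h15, h16, h17⟩
    refine ⟨⟨fun i => ?_, h3, fun j => ?_, fun j => ?_⟩, h8, by linarith,
      fun j => by linarith [h10 j], h11, h12, h13, h14, h15, h16, h17⟩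
    · rw [abs_le]; constructor <;> linarith [h1 i, h2 i]
    · rw [Matrix.mulVec_sub, Pi.sub_apply, abs_le]; constructor <;> linarith [h4 j, h5 j]
    · rw [Matrix.mulVec_sub, Pi.sub_apply, abs_le]; constructor <;> linarith [h6 j, h7 j]
  · rintro ⟨⟨h1, h3, h4, h6⟩, h8, h9, h10, h11, h12, h13, h14, h15, h16, h17⟩
    simp only [Matrix.mulVec_sub, Pi.sub_apply, abs_le] at h1 h4 h6
    refine ⟨fun i => ?_, fun i => ?_, h3, fun j => ?_, fun j => ?_, fun j => ?_, fun j => ?_, h8,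
      ?_, fun j => ?_, h11, h12, h13, h14, h15, h16, h17⟩
    · linarith [(h1 i).2]
    · linarith [(h1 i).1]
    · linarith [(h4 j).2]
    · linarith [(h4 j).1]
    · linarith [(h6 j).2]
    · linarith [(h6 j).1]
    · linarith
    · linarith [h10 j]

lemma system_iff :
    (matM₁ A M α *ᵥ colVec x t ξ v w₁ w₂ w₃ w₄ w₅ w₆ w₇ ≤ rhs₁ M y τ ∧
      matM₂ A M y τ *ᵥ colVec x t ξ v w₁ w₂ w₃ w₄ w₅ w₆ w₇ = 0) ↔
    PrimalFeasible A M y τ α x t ξ v ∧ DualFeasible A M α w₁ w₂ w₃ w₄ w₅ w₆ w₇ ∧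
      ∑ i, t i + τ * w₃ - y ⬝ᵥ (M *ᵥ (w₄ - w₅ - w₆ + w₇)) = 0 := by
  rw [matM₁_mulVec_le_iff, matM₂_mulVec]
  have h0 : ∀ (a : Fin n → ℝ) (b : Unit → ℝ), Sum.elim a b = 0 ↔ a = 0 ∧ b () = 0 := by
    intro a b
    constructor
    · intro h
      exact ⟨funext fun i => congr_fun h (.inl i), congr_fun h (.inr ())⟩
    · rintro ⟨rfl, hb⟩
      ext (i | i)
      · rfl
      · exact hb
  rw [h0, sub_eq_zero]
  constructor
  · rintro ⟨⟨hp, h8, h9, h10, h11, h12, h13, h14, h15, h16, h17⟩, he, h⟩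
    exact ⟨hp, ⟨h8, h9, h10, h11, h12, h13, h14, h15, h16, h17, he⟩, h⟩
  · rintro ⟨hp, ⟨h8, h9, h10, h11, h12, h13, h14, h15, h16, h17, he⟩, h⟩
    exact ⟨⟨hp, h8, h9, h10, h11, h12, h13, h14, h15, h16, h17⟩, he, h⟩

lemma PrimalFeasible.feasible (h : PrimalFeasible A M y τ α x t ξ v) (hτ : 0 ≤ τ) (hα₀ : 0 ≤ α)
    (hα₁ : α ≤ 1) : Feasible A M y τ α x := by
  -- For q = 0 nothing forces ξ ≥ 0, but both norms are then 0 and τ ≥ 0 suffices.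
  rcases isEmpty_or_nonempty (Fin q) with hq | ⟨⟨j₀⟩⟩
  · simpa [Feasible, lpN_one, lpN_top, Subsingleton.elim (Mᵀ *ᵥ (A *ᵥ x - y)) 0] using hτ
  refine le_trans (add_le_add (mul_le_mul_of_nonneg_left ?_ hα₀)
    (mul_le_mul_of_nonneg_left ?_ (sub_nonneg.2 hα₁))) h.le
  · exact lpN_top_le ((abs_nonneg _).trans (h.abs_le_xi j₀)) h.abs_le_xi
  · rw [lpN_one]
    exact Finset.sum_le_sum fun j _ => h.abs_le_v j

lemma Feasible.primalFeasible (h : Feasible A M y τ α x) :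
    PrimalFeasible A M y τ α x (fun i => |x i|) (lpN ⊤ (Mᵀ *ᵥ (A *ᵥ x - y)))
      (fun j => |(Mᵀ *ᵥ (A *ᵥ x - y)) j|) where
  abs_le_t _ := le_rfl
  le := by rw [← lpN_one]; exact h
  abs_le_xi := abs_le_lpN_top _
  abs_le_v _ := le_rfl

lemma dotProduct_mulVec_eq_sub (h : Fin q → ℝ) :
    y ⬝ᵥ (M *ᵥ h) = x ⬝ᵥ (Aᵀ *ᵥ (M *ᵥ h)) - (Mᵀ *ᵥ (A *ᵥ x - y)) ⬝ᵥ h := by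
  rw [Matrix.mulVec_transpose, Matrix.mulVec_transpose, ← Matrix.dotProduct_mulVec, sub_dotProduct,
    dotProduct_comm x, ← Matrix.dotProduct_mulVec, dotProduct_comm (M *ᵥ h)]
  ring

/-- Weak duality. -/
lemma DualFeasible.le_lpN_one (hw : DualFeasible A M α w₁ w₂ w₃ w₄ w₅ w₆ w₇)
    (hx : Feasible A M y τ α x) :
    y ⬝ᵥ (M *ᵥ (w₄ - w₅ - w₆ + w₇)) - τ * w₃ ≤ lpN 1 x := by
  rw [dotProduct_mulVec_eq_sub (A := A) (x := x), hw.eq]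
  set ϑ := Mᵀ *ᵥ (A *ᵥ x - y) with hϑ
  have h1 : x ⬝ᵥ (w₁ - w₂) ≤ lpN 1 x := by
    rw [lpN_one, dotProduct]
    refine Finset.sum_le_sum fun i _ => (le_abs_self _).trans ?_
    rw [abs_mul]
    refine mul_le_of_le_one_right (abs_nonneg _) ?_
    rw [Pi.sub_apply, abs_le]
    constructor <;> linarith [hw.add_le i, hw.nonneg₁ i, hw.nonneg₂ i]
  -- The two Hölder pairings: `w₄`, `w₅` against ‖ϑ‖_∞, and `w₆`, `w₇`, bounded entrywise, against
  -- ‖ϑ‖₁.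
  have h2 : -(ϑ ⬝ᵥ (w₄ - w₅ - w₆ + w₇)) ≤
      lpN ⊤ ϑ * (∑ j, w₄ j + ∑ j, w₅ j) + (1 - α) * w₃ * lpN 1 ϑ := by
    rw [lpN_one, dotProduct, ← Finset.sum_add_distrib, Finset.mul_sum, Finset.mul_sum,
      ← Finset.sum_add_distrib, ← Finset.sum_neg_distrib]
    refine Finset.sum_le_sum fun j _ => ?_
    have e1 : |ϑ j| * (w₄ j + w₅ j) ≤ lpN ⊤ ϑ * (w₄ j + w₅ j) :=
      mul_le_mul_of_nonneg_right (abs_le_lpN_top ϑ j) (add_nonneg (hw.nonneg₄ j) (hw.nonneg₅ j))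
    have e2 : (w₆ j + w₇ j) * |ϑ j| ≤ (1 - α) * w₃ * |ϑ j| :=
      mul_le_mul_of_nonneg_right (hw.le j) (abs_nonneg _)
    have e3 : -(ϑ j * (w₄ - w₅ - w₆ + w₇) j) ≤ |ϑ j| * (w₄ j + w₅ j + (w₆ j + w₇ j)) := by
      refine (neg_le_abs _).trans ?_
      rw [abs_mul]
      refine mul_le_mul_of_nonneg_left ?_ (abs_nonneg _)
      simp only [Pi.add_apply, Pi.sub_apply]
      rw [abs_le]
      constructor <;> linarith [hw.nonneg₄ j, hw.nonneg₅ j, hw.nonneg₆ j, hw.nonneg₇ j]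
    linarith
  have h3 := mul_le_mul_of_nonneg_left hw.sum_le (lpN_top_nonneg ϑ)
  have h4 := mul_le_mul_of_nonneg_right hx hw.nonneg₃
  rw [← hϑ] at h4
  linarith

lemma isOptimal_of_system (hτ : 0 ≤ τ) (hα₀ : 0 ≤ α) (hα₁ : α ≤ 1)
    (hp : PrimalFeasible A M y τ α x t ξ v) (hw : DualFeasible A M α w₁ w₂ w₃ w₄ w₅ w₆ w₇)
    (h : ∑ i, t i + τ * w₃ - y ⬝ᵥ (M *ᵥ (w₄ - w₅ - w₆ + w₇)) = 0) :
    IsOptimal A M y τ α x := by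
  refine ⟨hp.feasible hτ hα₀ hα₁, fun z hz => ?_⟩
  have h1 := hw.le_lpN_one hz
  have h2 : lpN 1 x ≤ ∑ i, t i := by
    rw [lpN_one]
    exact Finset.sum_le_sum fun i _ => hp.abs_le_t i
  linarith

/-- Full row rank makes Ax = y solvable, so the closed feasible set is nonempty; its point nearest
to 0 in `PiLp 1` is a minimizer. -/
lemma exists_isOptimal (hA : A.rank = m) (hτ : 0 ≤ τ) : ∃ x, IsOptimal A M y τ α x := by
  have : Fact ((1 : ℝ≥0∞) ≤ 1) := ⟨le_rfl⟩
  let s : Set (PiLp 1 fun _ : Fin n => ℝ) := {x | Feasible A M y τ α x.ofLp}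
  have hs : IsClosed s := by
    have h : Continuous fun w : PiLp 1 fun _ : Fin n => ℝ => w.ofLp := PiLp.continuous_ofLp 1 _
    have h1 : Continuous fun w : PiLp 1 fun _ : Fin n => ℝ => Mᵀ *ᵥ (A *ᵥ w.ofLp - y) :=
      continuous_const.matrix_mulVec ((continuous_const.matrix_mulVec h).sub continuous_const)
    refine isClosed_le (Continuous.add (continuous_const.mul ?_) (continuous_const.mul ?_))
      continuous_const
    · simp only [lpN_top]; exact h1.norm
    · simp only [lpN_one]
      exact continuous_finsetSum _ fun i _ => ((continuous_apply i).comp h1).abs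
  obtain ⟨x₀, hx₀⟩ := exists_mulVec_eq hA y
  have hne : s.Nonempty := ⟨WithLp.toLp 1 x₀, by
    simpa [s, Feasible, hx₀, lpN_one, lpN_top] using hτ⟩
  obtain ⟨x, hx, hd⟩ := hs.exists_infDist_eq_dist hne 0
  refine ⟨x.ofLp, hx, fun z hz => ?_⟩
  have h := Metric.infDist_le_dist_of_mem (x := 0) (s := s) (y := WithLp.toLp 1 z) hz
  rw [hd, dist_zero_left, dist_zero_left] at h
  exact h

end System

/-! ### Strong duality, the weak range space property and stability -/

section Stability

variable {m n q k : ℕ} {A : Matrix (Fin m) (Fin n) ℝ} {M : Matrix (Fin m) (Fin q) ℝ}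
  {y : Fin m → ℝ} {τ α : ℝ}

lemma rowVec_dotProduct (p₁ p₂ : Fin n → ℝ) (p₃ : ℝ) (p₄ p₅ p₆ p₇ : Fin q → ℝ) (p₈ : Fin n → ℝ)
    (p₉ : ℝ) (p₁₀ : Fin q → ℝ) (p₁₁ p₁₂ : Fin n → ℝ) (p₁₃ : ℝ) (p₁₄ p₁₅ p₁₆ p₁₇ : Fin q → ℝ)
    (b₁ b₂ : Fin n → ℝ) (b₃ : ℝ) (b₄ b₅ b₆ b₇ : Fin q → ℝ) (b₈ : Fin n → ℝ) :
    rowVec p₁ p₂ p₃ p₄ p₅ p₆ p₇ p₈ p₉ p₁₀ p₁₁ p₁₂ p₁₃ p₁₄ p₁₅ p₁₆ p₁₇ ⬝ᵥ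
      rowVec b₁ b₂ b₃ b₄ b₅ b₆ b₇ b₈ 0 0 0 0 0 0 0 0 0 =
    p₁ ⬝ᵥ b₁ + (p₂ ⬝ᵥ b₂ + (p₃ * b₃ + (p₄ ⬝ᵥ b₄ + (p₅ ⬝ᵥ b₅ + (p₆ ⬝ᵥ b₆ + (p₇ ⬝ᵥ b₇ +
      p₈ ⬝ᵥ b₈)))))) := by
  simp [rowVec, dotProduct, Fintype.sum_sum_type]

/-- Strong duality: the optimality system is solvable. -/
lemma exists_system (hA : A.rank = m) (hτ : 0 ≤ τ) (hα₀ : 0 ≤ α) (hα₁ : α ≤ 1) :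
    ∃ (x t : Fin n → ℝ) (ξ : ℝ) (v : Fin q → ℝ) (w₁ w₂ : Fin n → ℝ) (w₃ : ℝ)
      (w₄ w₅ w₆ w₇ : Fin q → ℝ), PrimalFeasible A M y τ α x t ξ v ∧
      DualFeasible A M α w₁ w₂ w₃ w₄ w₅ w₆ w₇ ∧
      ∑ i, t i + τ * w₃ - y ⬝ᵥ (M *ᵥ (w₄ - w₅ - w₆ + w₇)) = 0 := by
  obtain ⟨x, hx, hopt⟩ := exists_isOptimal (M := M) (y := y) (α := α) hA hτ
  have hprim := hx.primalFeasible
  set t : Fin n → ℝ := fun i => |x i| with ht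
  set ξ := lpN ⊤ (Mᵀ *ᵥ (A *ᵥ x - y)) with hξ
  set v : Fin q → ℝ := fun j => |(Mᵀ *ᵥ (A *ᵥ x - y)) j| with hv
  set g : Cols n q → ℝ := colVec 0 1 0 0 0 0 0 0 0 0 0 with hg
  have hgdot : ∀ (x t : Fin n → ℝ) (ξ : ℝ) (v : Fin q → ℝ) (w₁ w₂ : Fin n → ℝ) (w₃ : ℝ)
      (w₄ w₅ w₆ w₇ : Fin q → ℝ), g ⬝ᵥ colVec x t ξ v w₁ w₂ w₃ w₄ w₅ w₆ w₇ = ∑ i, t i := by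
    intros
    simp [hg, colVec, dotProduct, Fintype.sum_sum_type]
  -- The primal program is embedded in the full space of z with w = 0 and objective Σ t, without
  -- equality rows; the multipliers of the first seven blocks will be the dual solution.
  obtain ⟨p, r, hp0, hp, hact⟩ := exists_multipliers (matM₁ A M α)
    (0 : Matrix (Fin 0) (Cols n q) ℝ) (rhs₁ M y τ) 0 (colVec x t ξ v 0 0 0 0 0 0 0) g
    (matM₁_mulVec_le_iff.2 (by simpa using hprim)) (Subsingleton.elim _ _) (by
      intro z' hz' _
      obtain ⟨x', t', ξ', v', w₁, w₂, w₃, w₄, w₅, w₆, w₇, rfl⟩ := exists_eq_colVec z'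
      have hp' := (matM₁_mulVec_le_iff.1 hz').1
      rw [hgdot, hgdot]
      refine le_trans (le_of_eq (lpN_one x).symm) ((hopt x' (hp'.feasible hτ hα₀ hα₁)).trans ?_)
      rw [lpN_one]
      exact Finset.sum_le_sum fun i _ => hp'.abs_le_t i)
  rw [Matrix.vecMul_zero, add_zero] at hp
  obtain ⟨p₁, p₂, p₃, p₄, p₅, p₆, p₇, p₈, p₉, p₁₀, p₁₁, p₁₂, p₁₃, p₁₄, p₁₅, p₁₆, p₁₇, rfl⟩ :=
    exists_eq_rowVec p
  set p := rowVec p₁ p₂ p₃ p₄ p₅ p₆ p₇ p₈ p₉ p₁₀ p₁₁ p₁₂ p₁₃ p₁₄ p₁₅ p₁₆ p₁₇ with hpdef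
  have hM₁ : ∀ (x t : Fin n → ℝ) (ξ : ℝ) (v : Fin q → ℝ),
      matM₁ A M α *ᵥ colVec x t ξ v 0 0 0 0 0 0 0 =
      rowVec (x - t) (-x - t) (α * ξ + (1 - α) * ∑ j, v j) (Mᵀ *ᵥ (A *ᵥ x) - fun _ => ξ)
        (-(Mᵀ *ᵥ (A *ᵥ x)) - fun _ => ξ) (Mᵀ *ᵥ (A *ᵥ x) - v) (-(Mᵀ *ᵥ (A *ᵥ x)) - v) 0
        0 0 0 0 0 0 0 0 0 := by
    intro x t ξ v
    rw [matM₁_mulVec]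
    congr 1 <;> (try ext) <;> simp
  have hpair : ∀ (x t : Fin n → ℝ) (ξ : ℝ) (v : Fin q → ℝ),
      p₁ ⬝ᵥ (x - t) + (p₂ ⬝ᵥ (-x - t) + (p₃ * (α * ξ + (1 - α) * ∑ j, v j) +
        (p₄ ⬝ᵥ (Mᵀ *ᵥ (A *ᵥ x) - fun _ => ξ) + (p₅ ⬝ᵥ (-(Mᵀ *ᵥ (A *ᵥ x)) - fun _ => ξ) +
        (p₆ ⬝ᵥ (Mᵀ *ᵥ (A *ᵥ x) - v) + p₇ ⬝ᵥ (-(Mᵀ *ᵥ (A *ᵥ x)) - v)))))) = -∑ i, t i := by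
    intro x t ξ v
    have h1 : p ⬝ᵥ (matM₁ A M α *ᵥ colVec x t ξ v 0 0 0 0 0 0 0) = -∑ i, t i := by
      rw [Matrix.dotProduct_mulVec, hp, neg_dotProduct, hgdot]
    rw [← h1, hM₁, hpdef, rowVec_dotProduct, dotProduct_zero, add_zero]
  -- The rows w⁽¹⁾ + w⁽²⁾ ≤ 1 are inactive at w = 0. Otherwise their multipliers would enter the
  -- dual objective.
  have h8 : p₈ = 0 := by
    ext i
    by_contra h
    have := hact (.inr <| .inr <| .inr <| .inr <| .inr <| .inr <| .inr <| .inl i) h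
    rw [hM₁] at this
    exact zero_ne_one this
  have hobj : -∑ i, t i = p ⬝ᵥ rhs₁ M y τ := by
    rw [← hpair x t ξ v, ← add_zero (p₇ ⬝ᵥ _), ← dotProduct_zero p₈, ← rowVec_dotProduct
      p₁ p₂ p₃ p₄ p₅ p₆ p₇ p₈ p₉ p₁₀ p₁₁ p₁₂ p₁₃ p₁₄ p₁₅ p₁₆ p₁₇, ← hM₁, ← hpdef]
    refine Finset.sum_congr rfl fun i _ => ?_
    by_cases h : p i = 0
    · rw [h, zero_mul, zero_mul]
    · rw [hact i h]
  rw [hpdef, rhs₁, rowVec_dotProduct, h8] at hobj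
  -- Testing `hpair` on unit vectors in t, ξ, v and on arbitrary x isolates the dual constraints.
  have e1 : ∀ i, p₁ i + p₂ i = 1 := by
    intro i
    have := hpair 0 (Pi.single i 1) 0 0
    simp [← Pi.zero_def] at this
    linarith
  have e2 : α * p₃ - ∑ j, p₄ j - ∑ j, p₅ j = 0 := by
    have := hpair 0 0 1 0
    simp [dotProduct] at this
    linarith
  have e3 : ∀ j, (1 - α) * p₃ - p₆ j - p₇ j = 0 := by
    intro j
    have := hpair 0 0 0 (Pi.single j 1)
    simp [← Pi.zero_def] at this
    linarith
  have e4 : Aᵀ *ᵥ (M *ᵥ (p₅ - p₄ - p₆ + p₇)) = p₁ - p₂ := by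
    refine dotProduct_eq _ _ fun x => ?_
    have := hpair x 0 0 0
    simp [-Matrix.mulVec_mulVec, ← Pi.zero_def] at this
    rw [Matrix.mulVec_transpose, ← Matrix.dotProduct_mulVec, dotProduct_comm,
      Matrix.dotProduct_mulVec, ← Matrix.mulVec_transpose, dotProduct_comm]
    simp only [sub_dotProduct, add_dotProduct]
    linarith
  -- In the sign convention of the system, w⁽⁴⁾ belongs to the rows −MᵀAx − ξe, so `p₅` and `p₄`
  -- swap places.
  refine ⟨x, t, ξ, v, p₁, p₂, p₃, p₅, p₄, p₆, p₇, hprim, ⟨fun i => (e1 i).le, by linarith,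
    fun j => by linarith [e3 j], fun i => hp0 (.inl i), fun i => hp0 (.inr <| .inl i),
    hp0 (.inr <| .inr <| .inl ()), fun j => hp0 (.inr <| .inr <| .inr <| .inr <| .inl j),
    fun j => hp0 (.inr <| .inr <| .inr <| .inl j),
    fun j => hp0 (.inr <| .inr <| .inr <| .inr <| .inr <| .inl j),
    fun j => hp0 (.inr <| .inr <| .inr <| .inr <| .inr <| .inr <| .inl j), e4⟩, ?_⟩
  have e5 : y ⬝ᵥ (M *ᵥ (p₅ - p₄ - p₆ + p₇)) = (p₅ - p₄ - p₆ + p₇) ⬝ᵥ (Mᵀ *ᵥ y) := by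
    rw [Matrix.mulVec_transpose, Matrix.dotProduct_mulVec, dotProduct_comm]
  rw [e5]
  simp only [sub_dotProduct, add_dotProduct]
  simp only [dotProduct_zero, zero_dotProduct, dotProduct_neg] at hobj
  linarith

/-! ### The weak range space property -/

lemma RSP.weakRSP (h : RSP A k) : WeakRSP A k := by
  intro S₁ S₂ hd hc
  obtain ⟨ζ, h1, h2, h3, h4⟩ := h S₁ S₂ hd hc
  exact ⟨ζ, h1, h2, h3, fun i hi => (h4 i hi).le⟩

lemma NSP.sum_abs_le (h : NSP A k) {x₀ x : Fin n → ℝ} {S : Finset (Fin n)} (hS : S.card ≤ k)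
    (hx₀ : ∀ i ∉ S, x₀ i = 0) (hx : A *ᵥ x = A *ᵥ x₀) : ∑ i, |x₀ i| ≤ ∑ i, |x i| := by
  by_cases hd : x - x₀ = 0
  · rw [sub_eq_zero.1 hd]
  have h1 := h (x - x₀) hd (by rw [Matrix.mulVec_sub, hx, sub_self]) S hS
  rw [← Finset.sum_add_sum_compl S, ← Finset.sum_add_sum_compl S (fun i => |x i|)]
  have h2 : ∑ i ∈ S, |x₀ i| ≤ ∑ i ∈ S, |x i| + ∑ i ∈ S, |(x - x₀) i| := by
    rw [← Finset.sum_add_distrib]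
    refine Finset.sum_le_sum fun i _ => ?_
    have := abs_sub_abs_le_abs_sub (x₀ i) (x i)
    rw [abs_sub_comm] at this
    rw [Pi.sub_apply]
    linarith
  have h3 : ∑ i ∈ Sᶜ, |x₀ i| = 0 :=
    Finset.sum_eq_zero fun i hi => by rw [hx₀ i (Finset.mem_compl.1 hi), abs_zero]
  have h4 : ∑ i ∈ Sᶜ, |(x - x₀) i| = ∑ i ∈ Sᶜ, |x i| :=
    Finset.sum_congr rfl fun i hi => by rw [Pi.sub_apply, hx₀ i (Finset.mem_compl.1 hi), sub_zero]
  linarith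

/-- Exact recovery of the sign vector `x₀` combined with LP duality: M = 1, τ = 0, α = 1 turn the
constraint into Ax = Ax₀, and the dual solution yields ζ. -/
lemma NSP.weakRSP (hA : A.rank = m) (h : NSP A k) : WeakRSP A k := by
  intro S₁ S₂ hd hc
  set x₀ : Fin n → ℝ := fun i => if i ∈ S₁ then 1 else if i ∈ S₂ then -1 else 0 with hx₀
  obtain ⟨x, t, ξ, v, w₁, w₂, w₃, w₄, w₅, w₆, w₇, hp, hw, heq⟩ :=
    exists_system (M := (1 : Matrix (Fin m) (Fin m) ℝ)) (y := A *ᵥ x₀) (τ := 0) (α := 1) hA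
      le_rfl zero_le_one le_rfl
  have hAx : A *ᵥ x = A *ᵥ x₀ := by
    ext j
    have h1 := hp.abs_le_xi j
    have h2 := hp.le
    rw [Matrix.transpose_one, Matrix.one_mulVec] at h1
    have h3 : |(A *ᵥ x - A *ᵥ x₀) j| ≤ 0 := by linarith
    rw [abs_nonpos_iff, Pi.sub_apply, sub_eq_zero] at h3
    exact h3
  set u := (1 : Matrix (Fin m) (Fin m) ℝ) *ᵥ (w₄ - w₅ - w₆ + w₇) with hu
  have hζ : ∀ i, |(Aᵀ *ᵥ u) i| ≤ 1 := by
    intro i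
    rw [hw.eq, Pi.sub_apply, abs_le]
    constructor <;> linarith [hw.add_le i, hw.nonneg₁ i, hw.nonneg₂ i]
  have hx₀1 : ∀ i, |x₀ i| ≤ 1 := by
    intro i
    simp only [hx₀]
    split_ifs <;> simp
  -- Zero gap gives ‖x₀‖₁ ≤ Σ t = x₀·ζ, while |ζ| ≤ 1 gives the reverse bound termwise; hence
  -- equality in every entry, which fixes ζ on S₁ ∪ S₂.
  have hle : ∑ i, |x₀ i| ≤ ∑ i, x₀ i * (Aᵀ *ᵥ u) i := by
    have h1 : ∑ i, |x₀ i| ≤ ∑ i, |x i| := by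
      refine h.sum_abs_le (S := S₁ ∪ S₂) ((Finset.card_union_le _ _).trans hc) ?_ hAx
      intro i hi
      rw [Finset.mem_union, not_or] at hi
      simp [hx₀, hi.1, hi.2]
    have h2 : ∑ i, |x i| ≤ ∑ i, t i := Finset.sum_le_sum fun i _ => hp.abs_le_t i
    have h3 : (A *ᵥ x₀) ⬝ᵥ u = ∑ i, x₀ i * (Aᵀ *ᵥ u) i := by
      rw [dotProduct_comm, Matrix.dotProduct_mulVec, ← Matrix.mulVec_transpose, dotProduct_comm]
      rfl
    linarith
  have hterm : ∀ i, x₀ i * (Aᵀ *ᵥ u) i ≤ |x₀ i| := by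
    intro i
    refine (le_abs_self _).trans ?_
    rw [abs_mul]
    exact mul_le_of_le_one_right (abs_nonneg _) (hζ i)
  have heach : ∀ i, x₀ i * (Aᵀ *ᵥ u) i = |x₀ i| := by
    intro i
    exact (Finset.sum_eq_sum_iff_of_le fun i _ => hterm i).1
      (le_antisymm (Finset.sum_le_sum fun i _ => hterm i) hle) i (Finset.mem_univ i)
  refine ⟨Aᵀ *ᵥ u, ⟨u, rfl⟩, fun i hi => ?_, fun i hi => ?_, fun i _ => hζ i⟩
  · have := heach i
    simpa [hx₀, hi] using this
  · have h1 : i ∉ S₁ := fun h => Finset.disjoint_left.1 hd h hi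
    have := heach i
    simp only [hx₀, if_neg h1, if_pos hi, abs_neg, abs_one] at this
    linarith

/-! ### The error bound -/

lemma sum_compl_le_bestApprox {x : Fin n → ℝ} {T : Finset (Fin n)}
    (hT : ∀ S : Finset (Fin n), S.card ≤ k → ∑ i ∈ S, |x i| ≤ ∑ i ∈ T, |x i|) :
    ∑ i ∈ Tᶜ, |x i| ≤ bestApprox k x := by
  refine le_csInf ⟨_, 0, by simp [l0], rfl⟩ ?_
  rintro _ ⟨u, hu, rfl⟩
  set U : Finset (Fin n) := Finset.univ.filter fun i => u i ≠ 0 with hU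
  have hUk : U.card ≤ k := by
    rwa [l0, Set.ncard_eq_toFinset_card', Set.toFinset_ofPred] at hu
  have h1 := hT U hUk
  have h2 : ∑ i ∈ Uᶜ, |x i| ≤ lpN 1 (x - u) := by
    rw [lpN_one]
    refine le_trans (le_of_eq ?_) (Finset.sum_le_sum_of_subset_of_nonneg (Finset.subset_univ Uᶜ)
      fun i _ _ => abs_nonneg ((x - u) i))
    refine Finset.sum_congr rfl fun i hi => ?_
    have : u i = 0 := by simpa [hU] using hi
    rw [Pi.sub_apply, this, sub_zero]
  have h3 := Finset.sum_add_sum_compl U fun i => |x i|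
  have h4 := Finset.sum_add_sum_compl T fun i => |x i|
  linarith

/-- ζ follows the signs of x on its k largest entries, so only the tail contributes to the
difference, each entry at most 2|x i|. -/
lemma WeakRSP.exists_certificate (h : WeakRSP A k) (x : Fin n → ℝ) :
    ∃ u : Fin m → ℝ, (∀ i, |(Aᵀ *ᵥ u) i| ≤ 1) ∧
      |∑ i, |x i| - x ⬝ᵥ (Aᵀ *ᵥ u)| ≤ 2 * bestApprox k x := by
  obtain ⟨T, hTk, hT⟩ := exists_card_le_sum_max (fun i => |x i|) (fun i => abs_nonneg _) k
  -- Zero entries of x in `T` fall into the second set; there the sign of ζ does not matter.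
  obtain ⟨ζ, ⟨u, hu⟩, h1, h2, h3⟩ := h (T.filter fun i => 0 < x i) (T.filter fun i => ¬ 0 < x i)
    (Finset.disjoint_filter_filter_not _ _ _) (by
      rw [Finset.card_filter_add_card_filter_not]; exact hTk)
  subst hu
  set ζ := Aᵀ *ᵥ u with hζ
  have hζ1 : ∀ i, |ζ i| ≤ 1 := by
    intro i
    by_cases hiT : i ∈ T
    · by_cases hi : 0 < x i
      · rw [h1 i (by simp [hiT, hi])]; simp
      · rw [h2 i (by simp [hiT, not_lt.1 hi])]; simp
    · exact h3 i (by simp [hiT])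
  refine ⟨u, hζ1, ?_⟩
  have hle : x ⬝ᵥ ζ ≤ ∑ i, |x i| := by
    refine Finset.sum_le_sum fun i _ => (le_abs_self _).trans ?_
    rw [abs_mul]
    exact mul_le_of_le_one_right (abs_nonneg _) (hζ1 i)
  rw [abs_of_nonneg (sub_nonneg.2 hle)]
  have hbest := sum_compl_le_bestApprox hT
  have e1 : ∑ i ∈ T, x i * ζ i = ∑ i ∈ T, |x i| := by
    refine Finset.sum_congr rfl fun i hiT => ?_
    by_cases hi : 0 < x i
    · rw [h1 i (by simp [hiT, hi]), abs_of_pos hi, mul_one]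
    · rw [h2 i (by simp [hiT, not_lt.1 hi]), abs_of_nonpos (not_lt.1 hi)]; ring
  have e2 : -∑ i ∈ Tᶜ, x i * ζ i ≤ ∑ i ∈ Tᶜ, |x i| := by
    rw [← Finset.sum_neg_distrib]
    refine Finset.sum_le_sum fun i _ => (neg_le_abs _).trans ?_
    rw [abs_mul]
    exact mul_le_of_le_one_right (abs_nonneg _) (hζ1 i)
  rw [dotProduct, ← Finset.sum_add_sum_compl T, ← Finset.sum_add_sum_compl T fun i => x i * ζ i]
  linarith

/-- τ enters `rhs₁` only in the third block, so a vector feasible for another budget `τ'` has its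
whole residual there. -/
lemma sum_max_rowVec_sub_le {a : Rows₁ n q → ℝ} {τ' : ℝ} (h : a ≤ rhs₁ M y τ') :
    ∑ i, max (a i - rhs₁ M y τ i) 0 ≤ max (τ' - τ) 0 := by
  have h1 : ∀ i, i ≠ .inr (.inr (.inl ())) → (rhs₁ M y τ' : Rows₁ n q → ℝ) i = rhs₁ M y τ i := by
    rintro (i | i | i | i) hi
    · rfl
    · rfl
    · exact absurd rfl hi
    · rfl
  rw [Finset.sum_eq_single (.inr (.inr (.inl ())))]
  · exact max_le_max (sub_le_sub_right (h _) _) le_rfl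
  · intro i _ hi
    rw [max_eq_right]
    rw [← h1 i hi]
    exact sub_nonpos.2 (h i)
  · simp

theorem WeakRSP.exists_isOptimal_lpN_sub_le (hA : A.rank = m) (hM : M.rank = m) (hτ : 0 ≤ τ)
    (hα₀ : 0 ≤ α) (hα₁ : α ≤ 1) (h : WeakRSP A k) (x : Fin n → ℝ) :
    ∃ xs, IsOptimal A M y τ α xs ∧ lpN 2 (x - xs) ≤ gammaConst A M y τ α *
      (max (α * lpN ⊤ (Mᵀ *ᵥ (A *ᵥ x - y)) + (1 - α) * lpN 1 (Mᵀ *ᵥ (A *ᵥ x - y)) - τ) 0 +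
        2 * bestApprox k x + cConst A M * (τ + lpN ⊤ (Mᵀ *ᵥ (A *ᵥ x - y)))) := by
  obtain ⟨u, hζ, hbest⟩ := h.exists_certificate x
  obtain ⟨d, hd, hdc⟩ := exists_mulVec_eq_of_range hA hM hζ
  set ϑ := Mᵀ *ᵥ (A *ᵥ x - y) with hϑ
  set ζ := Aᵀ *ᵥ u with hζdef
  have hα₁' : 0 ≤ 1 - α := sub_nonneg.2 hα₁
  set w₃ := ∑ j, |d j| with hw₃
  have hw₃0 : 0 ≤ w₃ := Finset.sum_nonneg fun _ _ => abs_nonneg _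
  have hpm : ∀ r : ℝ, max r 0 + max (-r) 0 = |r| := fun r => by
    rcases le_total r 0 with h | h
    · rw [max_eq_right h, max_eq_left (by linarith), abs_of_nonpos h]; ring
    · rw [max_eq_left h, max_eq_right (by linarith), abs_of_nonneg h]; ring
  have hpm' : ∀ r : ℝ, max r 0 - max (-r) 0 = r := fun r => by
    rcases le_total r 0 with h | h
    · rw [max_eq_right h, max_eq_left (by linarith)]; ring
    · rw [max_eq_left h, max_eq_right (by linarith)]; ring
  set w₁ : Fin n → ℝ := fun i => max (ζ i) 0 with hw₁
  set w₂ : Fin n → ℝ := fun i => max (-ζ i) 0 with hw₂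
  -- The parts of `d` are split in the ratio α : 1 − α between the two dual groups, so that the
  -- signed combination is `d` and w⁽³⁾ = ‖d‖₁ meets both dual bounds.
  set w₄ : Fin q → ℝ := fun j => α * max (d j) 0 with hw₄
  set w₅ : Fin q → ℝ := fun j => α * max (-d j) 0 with hw₅
  set w₆ : Fin q → ℝ := fun j => (1 - α) * max (-d j) 0 with hw₆
  set w₇ : Fin q → ℝ := fun j => (1 - α) * max (d j) 0 with hw₇
  have hwd : w₄ - w₅ - w₆ + w₇ = d := by
    ext j
    simp only [hw₄, hw₅, hw₆, hw₇, Pi.add_apply, Pi.sub_apply]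
    linear_combination hpm' (d j)
  have hwζ : w₁ - w₂ = ζ := funext fun i => hpm' (ζ i)
  set z := colVec x (fun i => |x i|) (lpN ⊤ ϑ) (fun j => |ϑ j|) w₁ w₂ w₃ w₄ w₅ w₆ w₇ with hz
  obtain ⟨z', ⟨hz1, hz2⟩, hz3⟩ := exists_lpN_sub_le_robinson (matM₁ A M α) (matM₂ A M y τ)
    (rhs₁ M y τ) 0 (by
      obtain ⟨x, t, ξ, v, w₁, w₂, w₃, w₄, w₅, w₆, w₇, hp⟩ :=
        exists_system (M := M) (y := y) hA hτ hα₀ hα₁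
      exact ⟨_, system_iff.2 hp⟩) z
  obtain ⟨x', t', ξ', v', a₁, a₂, a₃, a₄, a₅, a₆, a₇, rfl⟩ := exists_eq_colVec z'
  obtain ⟨hp', hw', heq'⟩ := system_iff.1 ⟨hz1, hz2⟩
  refine ⟨x', isOptimal_of_system hτ hα₀ hα₁ hp' hw' heq', ?_⟩
  have hxz : lpN 2 (x - x') ≤
      lpN 2 (z - colVec x' t' ξ' v' a₁ a₂ a₃ a₄ a₅ a₆ a₇) := by
    refine le_of_sq_le_sq ?_ (lpN_two_nonneg _)
    rw [lpN_two_sq, lpN_two_sq, Fintype.sum_sum_type]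
    exact le_add_of_nonneg_right (Finset.sum_nonneg fun _ _ => sq_nonneg _)
  refine hxz.trans (hz3.trans (mul_le_mul_of_nonneg_left ?_ (robinson_nonneg _ _)))
  have hres₁ : ∑ i, max ((matM₁ A M α *ᵥ z) i - rhs₁ M y τ i) 0 ≤
      max (α * lpN ⊤ ϑ + (1 - α) * lpN 1 ϑ - τ) 0 := by
    apply sum_max_rowVec_sub_le
    -- x satisfies the constraint for the budget equal to its own constraint value.
    have hfeas : Feasible A M y (α * lpN ⊤ ϑ + (1 - α) * lpN 1 ϑ) α x := le_refl _
    refine matM₁_mulVec_le_iff.2 ⟨hfeas.primalFeasible, fun i => (hpm (ζ i)).trans_le (hζ i),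
      le_of_eq ?_, fun j => ?_, fun i => le_max_right _ _, fun i => le_max_right _ _, hw₃0,
      fun j => mul_nonneg hα₀ (le_max_right _ _), fun j => mul_nonneg hα₀ (le_max_right _ _),
      fun j => mul_nonneg hα₁' (le_max_right _ _), fun j => mul_nonneg hα₁' (le_max_right _ _)⟩
    · rw [← Finset.sum_add_distrib, hw₃, Finset.mul_sum]
      exact Finset.sum_congr rfl fun j _ => by rw [← hpm]; ring
    · have h1 : |d j| ≤ w₃ := Finset.single_le_sum (f := fun j => |d j|)
        (fun _ _ => abs_nonneg _) (Finset.mem_univ j)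
      have h2 : w₆ j + w₇ j = (1 - α) * |d j| := by rw [← hpm]; ring
      rw [h2]
      exact mul_le_mul_of_nonneg_left h1 hα₁'
  have hres₂ : ∑ j, |(matM₂ A M y τ *ᵥ z) j - (0 : Fin n ⊕ Unit → ℝ) j| ≤
      2 * bestApprox k x + cConst A M * (τ + lpN ⊤ ϑ) := by
    rw [hz, matM₂_mulVec, hwd, hwζ, hd, ← hζdef, Fintype.sum_sum_type]
    simp only [Sum.elim_inl, Sum.elim_inr, sub_self, Pi.zero_apply, abs_zero,
      Finset.sum_const_zero, sub_zero, zero_add, Finset.univ_unique, Finset.sum_singleton]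
    -- Only the gap row has a residual: |‖x‖₁ − x·ζ + ϑ·d + τ‖d‖₁|, whose last two terms are bounded
    -- through ‖d‖₁ ≤ c.
    have e1 : y ⬝ᵥ u = x ⬝ᵥ ζ - ϑ ⬝ᵥ d := by
      rw [← hd, dotProduct_mulVec_eq_sub (A := A) (x := x), hd]
    have e2 := (dotProduct_le_lpN ϑ d).trans (mul_le_mul_of_nonneg_left hdc (lpN_top_nonneg ϑ))
    have e3 := mul_le_mul_of_nonneg_left hdc hτ
    have e4 := mul_nonneg hτ hw₃0
    rw [e1]
    rw [abs_le] at hbest e2 ⊢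
    constructor <;> linarith
  linarith

lemma Feasible.lpN_top_le {x : Fin n → ℝ} (hx : Feasible A M y τ α x) (hα₁ : α ≤ 1) :
    lpN ⊤ (Mᵀ *ᵥ (A *ᵥ x - y)) ≤ τ := by
  have := mul_le_mul_of_nonneg_left (lpN_top_le_one (Mᵀ *ᵥ (A *ᵥ x - y))) (sub_nonneg.2 hα₁)
  have h : α * lpN ⊤ (Mᵀ *ᵥ (A *ᵥ x - y)) + (1 - α) * lpN 1 (Mᵀ *ᵥ (A *ᵥ x - y)) ≤ τ := hx
  linarith

end Stability

end DantzigStability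

end

/-! ### The stability theorem -/

theorem corollary3p3 {m n q : ℕ} (k : ℕ) (hmn : m < n) (hmq : m ≤ q)
    (A : Matrix (Fin m) (Fin n) ℝ) (M : Matrix (Fin m) (Fin q) ℝ)
    (hA : A.rank = m) (hM : M.rank = m)
    (y : Fin m → ℝ) (τ α : ℝ) (hτ : 0 ≤ τ) (hα₀ : 0 ≤ α) (hα₁ : α ≤ 1)
    (hcond :
      (DantzigStability.NormalizedCols A ∧
        DantzigStability.coherence A k + DantzigStability.coherence A (k - 1) < 1) ∨
      (∃ δ : ℝ, DantzigStability.RIP A (2 * k) δ ∧ δ < 1 / √2) ∨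
      (∃ ρ : ℝ, 0 < ρ ∧ ρ < 1 ∧ DantzigStability.StableNSP A k ρ) ∨
      (∃ ρ' ρ'' : ℝ, 0 < ρ' ∧ ρ' < 1 ∧ 0 < ρ'' ∧ DantzigStability.RobustNSP A k ρ' ρ'') ∨
      DantzigStability.NSP A k ∨
      DantzigStability.RSP A k) :
    DantzigStability.WeakRSP A k ∧
    (∀ x : Fin n → ℝ, ∃ xs : Fin n → ℝ, DantzigStability.IsOptimal A M y τ α xs ∧
      DantzigStability.lpN 2 (x - xs) ≤ DantzigStability.gammaConst A M y τ α *
        (max (α * DantzigStability.lpN ⊤ (Mᵀ *ᵥ (A *ᵥ x - y)) +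
              (1 - α) * DantzigStability.lpN 1 (Mᵀ *ᵥ (A *ᵥ x - y)) - τ) 0 +
          2 * DantzigStability.bestApprox k x +
          DantzigStability.cConst A M *
            (τ + DantzigStability.lpN ⊤ (Mᵀ *ᵥ (A *ᵥ x - y))))) ∧
    (∀ x : Fin n → ℝ, DantzigStability.Feasible A M y τ α x →
      ∃ xs : Fin n → ℝ, DantzigStability.IsOptimal A M y τ α xs ∧
        DantzigStability.lpN 2 (x - xs) ≤ DantzigStability.gammaConst A M y τ α *
          (2 * DantzigStability.bestApprox k x + DantzigStability.cConst A M * τ +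
            DantzigStability.cConst A M * DantzigStability.lpN ⊤ (Mᵀ *ᵥ (A *ᵥ x - y))) ∧
        DantzigStability.gammaConst A M y τ α *
          (2 * DantzigStability.bestApprox k x + DantzigStability.cConst A M * τ +
            DantzigStability.cConst A M * DantzigStability.lpN ⊤ (Mᵀ *ᵥ (A *ᵥ x - y))) ≤
          2 * DantzigStability.gammaConst A M y τ α *
            (DantzigStability.bestApprox k x + DantzigStability.cConst A M * τ)) := by
  have hW : DantzigStability.WeakRSP A k := by
    rcases hcond with ⟨hN, h⟩ | ⟨δ, h, hδ⟩ | ⟨ρ, -, hρ, h⟩ | ⟨ρ', ρ'', -, hρ', -, h⟩ | h | h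
    · exact (DantzigStability.nsp_of_coherence hN h).weakRSP hA
    · exact (h.nsp hδ).weakRSP hA
    · exact (h.nsp hρ).weakRSP hA
    · exact (h.stableNSP.nsp hρ').weakRSP hA
    · exact h.weakRSP hA
    · exact h.weakRSP
  refine ⟨hW, hW.exists_isOptimal_lpN_sub_le hA hM hτ hα₀ hα₁, fun x hx => ?_⟩
  obtain ⟨xs, hopt, hxs⟩ :=
    hW.exists_isOptimal_lpN_sub_le (y := y) hA hM hτ hα₀ hα₁ x
  have hle := DantzigStability.Feasible.lpN_top_le hx hα₁
  refine ⟨xs, hopt, hxs.trans (le_of_eq ?_), ?_⟩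
  · rw [max_eq_right (sub_nonpos.2 hx)]
    ring
  · have h1 := mul_le_mul_of_nonneg_left hle (DantzigStability.cConst_nonneg A M)
    have h2 : 2 * DantzigStability.bestApprox k x + DantzigStability.cConst A M * τ +
        DantzigStability.cConst A M * DantzigStability.lpN ⊤ (Mᵀ *ᵥ (A *ᵥ x - y)) ≤
        2 * (DantzigStability.bestApprox k x + DantzigStability.cConst A M * τ) := by linarith
    refine (mul_le_mul_of_nonneg_left h2 (DantzigStability.robinson_nonneg _ _)).trans
      (le_of_eq ?_)
    rw [DantzigStability.gammaConst]
    ring
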